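/- Let $F$ be a rooted forest with vertex set $V(F)$, $n = |V(F)|$, some of whose vertices may be marked as auxiliary. The vertices carry weights in a commutative group, and auxiliary vertices initially have weight zero. A tree-sum data structure supports the operations $\mathrm{cut}(v)$ (delete the edge between $v$ and its parent, which must exist), $\mathrm{update\text{-}weight}(v,x)$ (set the weight of $v$ to $x$) and $\mathrm{tree\text{-}sum}(v)$ (return the sum of the weights in the tree that currently contains $v$); operations may only be applied to non-auxiliary vertices. Data structures are deterministic and work in the group model: they are correct for every commutative group, group elements can only be stored, copied, added and subtracted, and the control flow never depends on group elements. For a tree-sum data structure $D$ and $m \in \mathbb{N}_0$, let $\mathrm{Time}(D,F,m)$ be the maximum number of additions and subtractions of group elements that $D$ performs (initialization included) on a legal sequence of $m$ operations with the initial forest $F$, over all initial weights and all such sequences, and let $\mathrm{OPT}(F,m)$ be the minimum of $\mathrm{Time}(D,F,m)$ over all tree-sum data structures $D$ (which may have $F$ and $m$ hard-coded). There is an absolute constant $C$ with the following property. Let $F$ be a forest on $n$ vertices, let $T_1, \dots, T_k$ be the trees induced by a partition of $V(F)$ into (non-empty) connected subsets, let $m_1, \dots, m_k \in \mathbb{N}_0$,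 and let $m = \sum_{i=1}^k m_i$. Then \[ \sum_{i=1}^k \mathrm{OPT}(T_i, 3m_i) \le C \cdot \bigl( \mathrm{OPT}(F,m) + n \bigr). \] -/

import Mathlib

universe u

/-- A rooted forest with vertex set `V`, some of whose vertices are marked as auxiliary.
Every vertex has at most one parent (roots have none), and the parent relation has no cycles. -/
structure RootedForest (V : Type u) where
  /-- the parent of a vertex, `none` for a root -/
  parent : V → Option V
  /-- the relation "`p` is the parent of `v`" is well-founded, i.e. there are no cycles -/
  wf : WellFounded (fun p v : V => parent v = some p)
  /-- the auxiliary vertices -/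
  aux : Set V

namespace RootedForest

variable {V : Type u}

/-- The underlying undirected graph. -/
def graph (F : RootedForest V) : SimpleGraph V :=
  SimpleGraph.fromRel (fun u v => F.parent u = some v)

open Classical in
/-- The subforest `F[U]` induced by a set `U` of vertices. -/
noncomputable def induce (F : RootedForest V) (U : Finset V) : RootedForest U where
  parent v := (F.parent v).bind fun p => if h : p ∈ U then some ⟨p, h⟩ else none
  wf := by
    refine Subrelation.wf ?_ (InvImage.wf (Subtype.val : U → V) F.wf)
    intro p v h
    obtain ⟨q, hq, h⟩ := Option.bind_eq_some_iff.mp h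
    by_cases hU : q ∈ U
    · rw [dif_pos hU, Option.some.injEq] at h
      subst h
      exact hq
    · rw [dif_neg hU] at h
      cases h
  aux := {v | (v : V) ∈ F.aux}

open Classical in
/-- Delete the edge between `v` and its parent. -/
noncomputable def cut (F : RootedForest V) (v : V) : RootedForest V where
  parent := Function.update F.parent v none
  wf := by
    refine Subrelation.wf ?_ F.wf
    intro p x h
    by_cases hx : x = v
    · subst hx
      rw [Function.update_self] at h
      cases h
    · rwa [Function.update_of_ne hx] at h
  aux := F.aux

open Classical in
/-- The sum of the weights in the tree of `F` that contains `v`. -/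
noncomputable def treeSum [Fintype V] {G : Type u} [AddCommGroup G]
    (F : RootedForest V) (w : V → G) (v : V) : G :=
  ∑ x : V with F.graph.Reachable v x, w x

end RootedForest

/-- The operations on a weighted forest with vertex set `V` and weights in `G`. -/
inductive Op (V : Type u) (G : Type u) where
  /-- delete the edge between `v` and its parent -/
  | cut (v : V)
  /-- report the total weight of the tree containing `v` -/
  | treeSum (v : V)
  /-- set the weight of `v` to `x` -/
  | updateWeight (v : V) (x : G)

/-- An operation without the weight parameter of `updateWeight`. This is all that the control flow
of a data structure in the group model can depend on. -/
abbrev OpShape (V : Type u) := Op V PUnit.{u + 1}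

namespace Op

variable {V G : Type u}

/-- Forget the weight parameter. -/
def shape : Op V G → OpShape V
  | cut v => cut v
  | treeSum v => treeSum v
  | updateWeight v _ => updateWeight v PUnit.unit

open Classical in
/-- The weights after an operation. -/
noncomputable def newWeights (w : V → G) : Op V G → V → G
  | cut _ => w
  | treeSum _ => w
  | updateWeight v x => Function.update w v x

end Op

namespace RootedForest

variable {V G : Type u}

/-- The forest after an operation. -/
noncomputable def apply (F : RootedForest V) : Op V G → RootedForest V
  | .cut v => F.cut v
  | .treeSum _ => F
  | .updateWeight _ _ => F

/-- No operation may be applied to an auxiliary vertex, and `cut v` needs that `v` has a parent. -/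
def LegalOp (F : RootedForest V) : Op V G → Prop
  | .cut v => v ∉ F.aux ∧ F.parent v ≠ none
  | .treeSum v => v ∉ F.aux
  | .updateWeight v _ => v ∉ F.aux

/-- Legal sequences of operations with the initial forest `F`. -/
def Legal : RootedForest V → List (Op V G) → Prop
  | _, [] => True
  | F, op :: ops => F.LegalOp op ∧ (F.apply op).Legal ops

/-- The correct answers to the `treeSum` operations of a sequence of operations, in order, with the
initial forest `F` and the initial weights `w`. -/
noncomputable def answers [Fintype V] [AddCommGroup G] :
    RootedForest V → (V → G) → List (Op V G) → List G
  | _, _, [] => []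
  | F, w, .cut v :: ops => (F.cut v).answers w ops
  | F, w, .treeSum v :: ops => F.treeSum w v :: F.answers w ops
  | F, w, .updateWeight v x :: ops => F.answers (Op.newWeights w (.updateWeight v x)) ops

end RootedForest

/-- A memory cell that holds a group element: a register `R[i]`, or the cell `W[v]` that holds the
current weight of the vertex `v`. -/
inductive Cell (V : Type u) where
  | reg (i : ℕ)
  | weight (v : V)

/-- The instructions on group elements: `R[i] ← X`, `R[i] ← X + Y` and `R[i] ← X - Y`. -/
inductive Instr (V : Type u) where
  | copy (i : ℕ) (X : Cell V)
  | add (i : ℕ) (X Y : Cell V)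
  | sub (i : ℕ) (X Y : Cell V)

/-- The content of a cell, for weights `w` and registers `R`. -/
def Cell.read {V G : Type u} (w : V → G) (R : ℕ → G) : Cell V → G
  | reg i => R i
  | weight v => w v

namespace Instr

variable {V G : Type u}

/-- The registers after an instruction. -/
def exec [AddCommGroup G] (w : V → G) (R : ℕ → G) : Instr V → ℕ → G
  | copy i X => Function.update R i (X.read w R)
  | add i X Y => Function.update R i (X.read w R + Y.read w R)
  | sub i X Y => Function.update R i (X.read w R - Y.read w R)

/-- The registers after a list of instructions, executed in order. -/
def execAll [AddCommGroup G] (w : V → G) (R : ℕ → G) (p : List (Instr V)) : ℕ → G :=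
  p.foldl (fun R' c => c.exec w R') R

/-- Only additions and subtractions of group elements are counted. -/
def cost : Instr V → ℕ
  | copy _ _ => 0
  | add _ _ _ => 1
  | sub _ _ _ => 1

/-- The number of additions and subtractions in a list of instructions. -/
def costAll (p : List (Instr V)) : ℕ := (p.map cost).sum

end Instr

/-- A deterministic online data structure in the group model, with the initial forest hard-coded.
All of its memory except the cells that hold group elements is the control state. Which
instructions on group elements are executed depends on the control state and on the operation at
hand, but never on group elements (and not on the group). -/
structure DataStructure (V : Type u) where
  /-- control states -/
  State : Type u
  /-- the control state after the initialization -/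
  init : State
  /-- the instructions executed during the initialization -/
  initProg : List (Instr V)
  /-- the control state after an operation -/
  next : State → OpShape V → State
  /-- the instructions executed when an operation is performed -/
  prog : State → OpShape V → List (Instr V)
  /-- the cell that is returned, at the end, by the operation `treeSum v` -/
  ret : State → V → Cell V

namespace DataStructure

variable {V : Type u}

/-- The values returned by the `treeSum` operations of a sequence of operations, when it is executed
from the control state `s`, with current weights `w` and registers `R`. -/
noncomputable def outputFrom {G : Type u} [AddCommGroup G] (D : DataStructure V) :
    D.State → (V → G) → (ℕ → G) → List (Op V G) → List G
  | _, _, _, [] => []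
  | s, w, R, op :: ops =>
    let w' := op.newWeights w
    let R' := Instr.execAll w' R (D.prog s op.shape)
    let rest := D.outputFrom (D.next s op.shape) w' R' ops
    match op with
    | .treeSum v => (D.ret s v).read w' R' :: rest
    | _ => rest

/-- The values returned by the `treeSum` operations of a sequence of operations, with initial
weights `w`; all registers are zero at the start. -/
noncomputable def output {G : Type u} [AddCommGroup G] (D : DataStructure V) (w : V → G)
    (ops : List (Op V G)) : List G :=
  D.outputFrom D.init w (Instr.execAll w (fun _ => 0) D.initProg) ops

/-- `D` is a tree-sum data structure for the initial forest `F`: for every commutative group, all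
initial weights that vanish on auxiliary vertices and every legal sequence of operations, of any
length, it returns the correct answers. -/
def IsTreeSumFor [Fintype V] (D : DataStructure V) (F : RootedForest V) : Prop :=
  ∀ (G : Type u) [AddCommGroup G] (w : V → G), (∀ v ∈ F.aux, w v = 0) →
    ∀ ops : List (Op V G), F.Legal ops → D.output w ops = F.answers w ops

/-- The number of additions and subtractions in the execution of a sequence of operations from the
control state `s`. -/
def costFrom (D : DataStructure V) : D.State → List (OpShape V) → ℕ
  | _, [] => 0
  | s, op :: ops => Instr.costAll (D.prog s op) + D.costFrom (D.next s op) ops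

/-- The number of additions and subtractions in the initialization and the execution of a sequence
of operations. It does not depend on weights. -/
def cost (D : DataStructure V) (ops : List (OpShape V)) : ℕ :=
  Instr.costAll D.initProg + D.costFrom D.init ops

/-- `Time(D, F, m)`: the maximum number of additions and subtractions that `D` performs on a legal
sequence of `m` operations with the initial forest `F`. -/
noncomputable def time (D : DataStructure V) (F : RootedForest V) (m : ℕ) : ℕ∞ :=
  ⨆ ops ∈ {ops : List (OpShape V) | F.Legal ops ∧ ops.length = m}, (D.cost ops : ℕ∞)

end DataStructure

/-- `OPT(F, m)`: the minimum of `Time(D, F, m)` over all tree-sum data structures `D`. -/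
noncomputable def OPT {V : Type u} [Fintype V] (F : RootedForest V) (m : ℕ) : ℕ∞ :=
  ⨅ D ∈ {D : DataStructure V | D.IsTreeSumFor F}, D.time F m

/-! Control flow never depends on group elements. Hence a structure `D` for `F` can be taken over in
any reachable control state, with all its weights zero, and made the engine of a structure for a
forest `H` embedded in the current forest of `D`. By `exists_simulation` this costs at most one
addition per vertex of `H` at the start, and per operation at most two additions and three
operations of `D`.

Entering the initial weights into `D` would need an update per vertex. Instead the simulation keeps,
for each vertex, the error (true weight minus the weight in `D`), and the sums of errors below all
non-auxiliary vertices and all roots. A tree sum is the answer of `D` plus the error sum at the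
root. When the edge above `v` is cut, the error sum below `v` is moved to the nearest non-auxiliary
proper ancestor by one weight update in `D`; then no tracked sum changes (`cut_descSum_update`). If
there is no such ancestor, only the sum at the root is corrected.

The simulation is used twice. In `exists_sum_OPT_induce_le`, one `D` that is optimal for `F` and `9
* m` operations serves the parts one after another. A worst sequence for the simulation on part `i`
becomes at most `9 * ms i` operations of `D` whose cuts stay inside the part, so the other parts
remain intact. Concatenation bounds the left-hand side by n + 6m + OPT(F, 9m).

In `OPT_nine_mul_le`, 9m operations are covered by 45 phases of ⌊m/3⌋ operations each. Each phase
starts a new structure for the current forest, which simulates an optimal one for `F` on 3⌊m/3⌋ ≤ m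
operations. Edges that are already gone from the current forest still exist in `F`; they are cut
lazily, at most one per operation (`Coupled.exists_activate`). This gives OPT(F, 9m) = O(n + m +
OPT(F, m)).

Finally m ≤ 3 OPT(F, m) + 2 by `le_three_mul_OPT_add_two`, unless no tree of `F` has two
non-auxiliary vertices; in that case the left-hand side is zero. -/

/-! ### Ancestors, cuts and subtree sums in rooted forests -/

namespace RootedForest

variable {V : Type u} {F : RootedForest V} {a b p v x y : V}

/-- `a` is an ancestor of `x`, possibly `x` itself. -/
def Anc (F : RootedForest V) : V → V → Prop :=
  Relation.ReflTransGen (fun x p => F.parent x = some p)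

theorem Anc.refl (x : V) : F.Anc x x := Relation.ReflTransGen.refl

theorem Anc.trans (h : F.Anc x y) (h' : F.Anc y a) : F.Anc x a := Relation.ReflTransGen.trans h h'

theorem Anc.of_parent (h : F.parent x = some p) : F.Anc x p := Relation.ReflTransGen.single h

theorem Anc.head (h : F.parent x = some p) (h' : F.Anc p a) : F.Anc x a :=
  Relation.ReflTransGen.head h h'

theorem Anc.cases_parent (h : F.Anc x a) : x = a ∨ ∃ p, F.parent x = some p ∧ F.Anc p a := by
  rcases Relation.ReflTransGen.cases_head h with h | h
  · exact Or.inl h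
  · exact Or.inr h

theorem Anc.of_parent_eq (h : F.Anc x a) (hp : F.parent x = some p) (hne : x ≠ a) : F.Anc p a := by
  rcases h.cases_parent with h | ⟨q, hq, h⟩
  · exact absurd h hne
  · rw [hp, Option.some.injEq] at hq
    exact hq ▸ h

theorem Anc.comparable (h : F.Anc x a) (h' : F.Anc x b) : F.Anc a b ∨ F.Anc b a := by
  refine Relation.ReflTransGen.total_of_right_unique ?_ h h'
  intro x p q hp hq
  rw [hp] at hq
  exact Option.some.inj hq

theorem not_anc_of_parent (h : F.parent x = some p) : ¬ F.Anc p x := by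
  intro h'
  have : Relation.TransGen (fun x p => F.parent x = some p) x x := Relation.TransGen.head' h h'
  have h2 : Relation.TransGen (fun p x => F.parent x = some p) x x := by
    rw [← Relation.transGen_swap] at this
    exact this
  exact F.wf.transGen.asymmetric _ _ h2 h2

theorem Anc.antisymm (h : F.Anc x y) (h' : F.Anc y x) : x = y := by
  rcases h.cases_parent with h | ⟨q, hq, h⟩
  · exact h
  · exact absurd (h.trans h') (not_anc_of_parent hq)

theorem Anc.eq_of_root (h : F.Anc x a) (hx : F.parent x = none) : x = a := by
  rcases h.cases_parent with h | ⟨q, hq, h⟩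
  · exact h
  · rw [hx] at hq
    cases hq

theorem Anc.of_root (h : F.Anc x a) (h' : F.Anc x b) (hb : F.parent b = none) : F.Anc a b := by
  rcases h.comparable h' with h | h
  · exact h
  · rw [h.eq_of_root hb]
    exact Anc.refl _

theorem exists_root (F : RootedForest V) (x : V) : ∃ r, F.Anc x r ∧ F.parent r = none := by
  induction x using F.wf.induction with
  | _ x ih =>
    cases hx : F.parent x with
    | none => exact ⟨x, Anc.refl x, hx⟩
    | some p =>
      obtain ⟨r, hr, hr'⟩ := ih p hx
      exact ⟨r, hr.head hx, hr'⟩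

theorem Anc.reachable (h : F.Anc x a) : F.graph.Reachable x a := by
  induction h using Relation.ReflTransGen.head_induction_on with
  | refl => exact SimpleGraph.Reachable.refl _
  | head h _ ih =>
    refine SimpleGraph.Reachable.trans (SimpleGraph.Adj.reachable ?_) ih
    rw [graph, SimpleGraph.fromRel_adj]
    refine ⟨?_, Or.inl h⟩
    rintro rfl
    exact not_anc_of_parent h (Anc.refl _)

theorem reachable_iff : F.graph.Reachable x y ↔ ∃ a, F.Anc x a ∧ F.Anc y a := by
  constructor
  · rintro ⟨w⟩
    induction w with
    | nil => exact ⟨_, Anc.refl _, Anc.refl _⟩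
    | @cons x y z h _ ih =>
      obtain ⟨a, hy, hz⟩ := ih
      rw [graph, SimpleGraph.fromRel_adj] at h
      rcases h.2 with h' | h'
      · exact ⟨a, hy.head h', hz⟩
      · rcases hy.cases_parent with rfl | ⟨q, hq, hq'⟩
        · exact ⟨x, Anc.refl x, hz.trans (Anc.of_parent h')⟩
        · rw [h', Option.some.injEq] at hq
          exact ⟨a, hq ▸ hq', hz⟩
  · rintro ⟨a, hx, hy⟩
    exact hx.reachable.trans hy.reachable.symm

theorem reachable_iff_anc_root {r : V} (hx : F.Anc x r) (hr : F.parent r = none) :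
    F.graph.Reachable x y ↔ F.Anc y r := by
  rw [reachable_iff]
  constructor
  · rintro ⟨a, ha, hy⟩
    exact hy.trans (ha.of_root hx hr)
  · exact fun h => ⟨r, hx, h⟩

open Classical in
theorem cut_parent_of_ne (h : x ≠ v) : (F.cut v).parent x = F.parent x :=
  Function.update_of_ne h _ _

open Classical in
theorem cut_parent_self : (F.cut v).parent v = none := by
  simp [cut]

/-- The path from `x` up to `a` uses the deleted edge exactly when `x` lies below `v` and `a` does
not. -/
theorem cut_anc_iff : (F.cut v).Anc x a ↔ F.Anc x a ∧ (F.Anc x v → F.Anc a v) := by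
  constructor
  · intro h
    induction h using Relation.ReflTransGen.head_induction_on with
    | refl => exact ⟨Anc.refl _, id⟩
    | @head x p h _ ih =>
      have hx : x ≠ v := by
        rintro rfl
        rw [cut_parent_self] at h
        cases h
      rw [cut_parent_of_ne hx] at h
      exact ⟨ih.1.head h, fun h' => ih.2 (h'.of_parent_eq h hx)⟩
  · rintro ⟨h, h'⟩
    induction h using Relation.ReflTransGen.head_induction_on with
    | refl => exact Anc.refl _
    | @head x p h hp ih =>
      have hx : x ≠ v := by
        rintro rfl
        exact not_anc_of_parent h (Anc.trans hp (h' (Anc.refl _)))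
      refine Anc.head ?_ (ih fun h1 => h' (h1.head h))
      rw [cut_parent_of_ne hx, h]

theorem cut_reachable_iff : (F.cut v).graph.Reachable x y ↔
    F.graph.Reachable x y ∧ (F.Anc x v ↔ F.Anc y v) := by
  simp only [reachable_iff, cut_anc_iff]
  constructor
  · rintro ⟨a, ⟨hx, hx'⟩, hy, hy'⟩
    exact ⟨⟨a, hx, hy⟩, fun h => hy.trans (hx' h), fun h => hx.trans (hy' h)⟩
  · rintro ⟨⟨a, hx, hy⟩, h⟩
    by_cases hv : F.Anc x v
    · exact ⟨v, ⟨hv, fun _ => Anc.refl v⟩, h.1 hv, fun _ => Anc.refl v⟩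
    · exact ⟨a, ⟨hx, fun h1 => absurd h1 hv⟩, hy, fun h1 => absurd (h.2 h1) hv⟩

/-- Weight updates are legal only at non-auxiliary vertices. When the edge above `v` is cut, the
ancestor found here takes over the error below `v`. -/
theorem exists_nearest_nonaux (h : ∃ y, y ∉ F.aux ∧ F.Anc v y ∧ v ≠ y) :
    ∃ a, (a ∉ F.aux ∧ F.Anc v a ∧ v ≠ a) ∧ ∀ y, y ∉ F.aux → F.Anc v y → v ≠ y → F.Anc a y := by
  induction v using F.wf.induction with
  | _ v ih =>
    obtain ⟨y, hy, hvy, hne⟩ := h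
    obtain rfl | ⟨p, hp, hpy⟩ := hvy.cases_parent
    · exact absurd rfl hne
    by_cases hpa : p ∈ F.aux
    · obtain ⟨a, ⟨ha, hpa', _⟩, ha'⟩ := ih p hp ⟨y, hy, hpy, fun h => hy (h ▸ hpa)⟩
      refine ⟨a, ⟨ha, hpa'.head hp, ?_⟩, fun z hz hvz hne => ?_⟩
      · rintro rfl
        exact not_anc_of_parent hp hpa'
      · exact ha' z hz (hvz.of_parent_eq hp hne) fun h => hz (h ▸ hpa)
    · refine ⟨p, ⟨hpa, Anc.of_parent hp, ?_⟩, fun z _ hvz hne => hvz.of_parent_eq hp hne⟩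
      rintro rfl
      exact not_anc_of_parent hp (Anc.refl _)

section Sums

variable [Fintype V] {G : Type u} [AddCommGroup G]

open Classical in
/-- The sum of `f` over the descendants of `y`. -/
noncomputable def descSum (F : RootedForest V) (f : V → G) (y : V) : G :=
  ∑ x : V with F.Anc x y, f x

open Classical in
theorem treeSum_eq_descSum {r : V} (f : V → G) (hx : F.Anc x r) (hr : F.parent r = none) :
    F.treeSum f x = F.descSum f r := by
  rw [treeSum, descSum]
  refine Finset.sum_congr (Finset.filter_congr fun y _ => ?_) fun _ _ => rfl
  exact reachable_iff_anc_root hx hr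

open Classical in
theorem descSum_eq_add_children (F : RootedForest V) (f : V → G) (y : V) :
    F.descSum f y = f y + ∑ c : V with F.parent c = some y, F.descSum f c := by
  simp only [descSum]
  rw [← Finset.sum_biUnion, ← Finset.sum_insert]
  · refine Finset.sum_congr ?_ fun _ _ => rfl
    ext x
    simp only [Finset.mem_filter, Finset.mem_univ, true_and, Finset.mem_insert, Finset.mem_biUnion]
    constructor
    · intro h
      rcases Relation.ReflTransGen.cases_tail h with h | ⟨c, h, hc⟩
      · exact Or.inl h.symm
      · exact Or.inr ⟨c, hc, h⟩
    · rintro (rfl | ⟨c, hc, h⟩)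
      · exact Anc.refl _
      · exact Relation.ReflTransGen.tail h hc
  · simp only [Finset.mem_filter, Finset.mem_univ, true_and, Finset.mem_biUnion, not_exists, not_and]
    exact fun c hc => not_anc_of_parent hc
  · intro c hc d hd hne
    simp only [Finset.coe_filter, Finset.mem_univ, true_and, Set.mem_ofPred_eq] at hc hd
    rw [Function.onFun, Finset.disjoint_left]
    simp only [Finset.mem_filter, Finset.mem_univ, true_and]
    intro x hxc hxd
    rcases hxc.comparable hxd with h | h
    · exact not_anc_of_parent hd (h.of_parent_eq hc hne)
    · exact not_anc_of_parent hc (h.of_parent_eq hd hne.symm)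

open Classical in
theorem cut_descSum_of_not (f : V → G) (h : ¬ (F.Anc v y ∧ v ≠ y)) :
    (F.cut v).descSum f y = F.descSum f y := by
  refine Finset.sum_congr (Finset.filter_congr fun x _ => ?_) fun _ _ => rfl
  rw [cut_anc_iff]
  refine ⟨And.left, fun hxy => ⟨hxy, fun hxv => ?_⟩⟩
  rcases hxy.comparable hxv with h' | h'
  · exact h'
  · have : v = y := by
      by_contra hne
      exact h ⟨h', hne⟩
    exact this ▸ Anc.refl _

open Classical in
theorem cut_descSum_of_anc (f : V → G) (h : F.Anc v y) (hne : v ≠ y) :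
    (F.cut v).descSum f y = F.descSum f y - F.descSum f v := by
  rw [eq_sub_iff_add_eq]
  simp only [descSum]
  rw [← Finset.sum_union]
  · refine Finset.sum_congr ?_ fun _ _ => rfl
    ext x
    simp only [Finset.mem_union, Finset.mem_filter, Finset.mem_univ, true_and, cut_anc_iff]
    have hyv : ¬ F.Anc y v := fun h' => hne (h.antisymm h')
    have := fun h' : F.Anc x v => h'.trans h
    tauto
  · rw [Finset.disjoint_left]
    simp only [Finset.mem_filter, Finset.mem_univ, true_and, cut_anc_iff]
    rintro x ⟨_, h1⟩ h2
    exact hne (h.antisymm (h1 h2))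

open Classical in
theorem descSum_update (f : V → G) (z : V) (g : G) :
    F.descSum (Function.update f z (f z + g)) y = F.descSum f y + if F.Anc z y then g else 0 := by
  have : Function.update f z (f z + g) = fun x => f x + if x = z then g else 0 := by
    funext x
    by_cases h : x = z
    · subst h
      simp
    · simp [h]
  rw [this]
  simp only [descSum, Finset.sum_add_distrib]
  congr 1
  rw [Finset.sum_ite_eq']
  simp

open Classical in
/-- Deleting the edge above `v` and moving the sum below `v` to the nearest ancestor of `v` that is
not auxiliary preserves the sums below all roots and all vertices that are not auxiliary. -/
theorem cut_descSum_update {E S : V → G} (hv : v ∉ F.aux)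
    (hS : ∀ y, (y ∉ F.aux ∨ F.parent y = none) → F.descSum E y = S y)
    (hva : F.Anc v a) (hne : v ≠ a)
    (ha : ∀ y, y ∉ F.aux → F.Anc v y → v ≠ y → F.Anc a y)
    (hy : y ∉ F.aux ∨ (F.cut v).parent y = none) :
    (F.cut v).descSum (Function.update E a (E a + S v)) y = S y := by
  have hy' : y ∉ F.aux ∨ F.parent y = none := by
    rcases hy with hy | hy
    · exact Or.inl hy
    · by_cases h : y = v
      · exact Or.inl (h ▸ hv)
      · rw [cut_parent_of_ne h] at hy
        exact Or.inr hy
  have hav : ¬ F.Anc a v := fun h => hne (hva.antisymm h)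
  rw [descSum_update]
  -- A proper ancestor `y` of `v` loses `S v` by the cut and regains it through `a`, since `y` lies
  -- above `a`: by the choice of `a` if `y` is not auxiliary, and as a root otherwise. For all other
  -- `y` neither change matters.
  by_cases hvy : F.Anc v y ∧ v ≠ y
  · rw [cut_descSum_of_anc _ hvy.1 hvy.2, hS y hy', hS v (Or.inl hv), if_pos, sub_add_cancel]
    rw [cut_anc_iff]
    refine ⟨?_, fun h => absurd h hav⟩
    rcases hy' with hy' | hy'
    · exact ha y hy' hvy.1 hvy.2
    · exact hva.of_root hvy.1 hy'
  · rw [cut_descSum_of_not _ hvy, hS y hy', if_neg, add_zero]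
    rw [cut_anc_iff]
    rintro ⟨h, -⟩
    refine hvy ⟨hva.trans h, ?_⟩
    rintro rfl
    exact hav h

open Classical in
/-- If all ancestors of `v` are auxiliary, then deleting the edge above `v` only changes the sum
below the root. -/
theorem cut_descSum_of_forall_aux {E S : V → G} {r : V} (hv : v ∉ F.aux)
    (hS : ∀ y, (y ∉ F.aux ∨ F.parent y = none) → F.descSum E y = S y)
    (hvr : F.Anc v r) (hr : F.parent r = none) (hne : v ≠ r)
    (ha : ∀ y, y ∉ F.aux → F.Anc v y → v = y)
    (hy : y ∉ F.aux ∨ (F.cut v).parent y = none) :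
    (F.cut v).descSum E y = Function.update S r (S r - S v) y := by
  have hy' : y ∉ F.aux ∨ F.parent y = none := by
    rcases hy with hy | hy
    · exact Or.inl hy
    · by_cases h : y = v
      · exact Or.inl (h ▸ hv)
      · rw [cut_parent_of_ne h] at hy
        exact Or.inr hy
  by_cases hyr : y = r
  · subst hyr
    rw [Function.update_self, cut_descSum_of_anc _ hvr hne, hS y hy', hS v (Or.inl hv)]
  · rw [Function.update_of_ne hyr, cut_descSum_of_not, hS y hy']
    rintro ⟨h1, h2⟩
    rcases hy' with hy' | hy'
    · exact h2 (ha y hy' h1)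
    · exact hyr ((hvr.of_root h1 hy').eq_of_root hr).symm

end Sums

end RootedForest

/-! ### Operation shapes, legal sequences and register programs -/

namespace Op

variable {V G : Type u}

theorem shape_shape (op : OpShape V) : op.shape = op := by
  cases op <;> rfl

/-- The operation with all weights set to zero. -/
def ofShape [Zero G] : OpShape V → Op V G
  | cut v => cut v
  | treeSum v => treeSum v
  | updateWeight v _ => updateWeight v 0

theorem shape_ofShape [Zero G] (op : OpShape V) : (ofShape op : Op V G).shape = op := by
  cases op <;> rfl

theorem newWeights_ofShape [Zero G] (op : OpShape V) :
    (ofShape op : Op V G).newWeights (fun _ => 0) = fun _ => 0 := by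
  cases op with
  | cut v => rfl
  | treeSum v => rfl
  | updateWeight v x =>
    funext z
    simp [ofShape, newWeights, Function.update_apply]

end Op

namespace RootedForest

variable {V G : Type u}

theorem apply_shape (F : RootedForest V) (op : Op V G) : F.apply op.shape = F.apply op := by
  cases op <;> rfl

theorem legalOp_shape {F : RootedForest V} {op : Op V G} : F.LegalOp op.shape ↔ F.LegalOp op := by
  cases op <;> rfl

theorem apply_aux (F : RootedForest V) (op : Op V G) : (F.apply op).aux = F.aux := by
  cases op <;> rfl

/-- The forest after a sequence of operations. -/
noncomputable def applyAll (F : RootedForest V) (ops : List (Op V G)) : RootedForest V :=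
  ops.foldl apply F

theorem applyAll_cons (F : RootedForest V) (op : Op V G) (ops : List (Op V G)) :
    F.applyAll (op :: ops) = (F.apply op).applyAll ops := rfl

theorem applyAll_append (F : RootedForest V) (ops ops' : List (Op V G)) :
    F.applyAll (ops ++ ops') = (F.applyAll ops).applyAll ops' :=
  List.foldl_append

theorem applyAll_aux (F : RootedForest V) (ops : List (Op V G)) : (F.applyAll ops).aux = F.aux := by
  induction ops generalizing F with
  | nil => rfl
  | cons op ops ih => rw [applyAll_cons, ih, apply_aux]

theorem legal_append {F : RootedForest V} {ops ops' : List (Op V G)} :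
    F.Legal (ops ++ ops') ↔ F.Legal ops ∧ (F.applyAll ops).Legal ops' := by
  induction ops generalizing F with
  | nil => simp [Legal, applyAll]
  | cons op ops ih =>
    rw [List.cons_append, Legal, Legal, ih, applyAll_cons, and_assoc]

theorem legal_replicate_treeSum {F : RootedForest V} {v : V} (hv : v ∉ F.aux) (n : ℕ) :
    F.Legal (List.replicate n (.treeSum v : Op V G)) := by
  induction n with
  | zero => trivial
  | succ n ih => exact ⟨hv, ih⟩

end RootedForest

namespace Instr

variable {V G : Type u} [AddCommGroup G]

theorem execAll_append (w : V → G) (R : ℕ → G) (p q : List (Instr V)) :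
    execAll w R (p ++ q) = execAll w (execAll w R p) q :=
  List.foldl_append

theorem execAll_cons (w : V → G) (R : ℕ → G) (c : Instr V) (p : List (Instr V)) :
    execAll w R (c :: p) = execAll w (c.exec w R) p := rfl

theorem execAll_nil (w : V → G) (R : ℕ → G) : execAll w R [] = R := rfl

theorem costAll_append (p q : List (Instr V)) : costAll (p ++ q) = costAll p + costAll q := by
  simp [costAll]

theorem costAll_cons (c : Instr V) (p : List (Instr V)) : costAll (c :: p) = c.cost + costAll p := by
  simp [costAll]

theorem execAll_zero (p : List (Instr V)) :
    execAll (fun _ => (0 : G)) (fun _ => 0) p = fun _ => 0 := by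
  induction p with
  | nil => rfl
  | cons c p ih =>
    rw [execAll_cons]
    have hread : ∀ X : Cell V, X.read (fun _ => (0 : G)) (fun _ => 0) = 0 := by
      intro X
      cases X <;> rfl
    have : c.exec (fun _ => (0 : G)) (fun _ => 0) = fun _ => 0 := by
      cases c <;> simp only [exec, hread, add_zero, sub_zero] <;> exact Function.update_eq_self _ _
    rw [this, ih]

end Instr

/-! ### Reachable configurations and costs -/

namespace DataStructure

variable {V : Type u}

/-- The configurations (forest, control state, weights, registers) that `D` can reach by legal
operations on the initial forest `F`. -/
inductive Reach (D : DataStructure V) (F : RootedForest V) {G : Type u} [AddCommGroup G] :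
    RootedForest V → D.State → (V → G) → (ℕ → G) → Prop
  | init (w : V → G) (hw : ∀ v ∈ F.aux, w v = 0) :
    Reach D F F D.init w (Instr.execAll w (fun _ => 0) D.initProg)
  | step {Fc : RootedForest V} {s : D.State} {w : V → G} {R : ℕ → G} (h : Reach D F Fc s w R)
    (op : Op V G) (hop : Fc.LegalOp op) :
    Reach D F (Fc.apply op) (D.next s op.shape) (op.newWeights w)
      (Instr.execAll (op.newWeights w) R (D.prog s op.shape))

section Correctness

variable {D : DataStructure V} {F Fc : RootedForest V} {s : D.State}

/-- A run over the trivial group can be replayed over `G` with all weights and all updates zero,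
because the control flow is the same. So `Reach` over `PUnit` expresses that a control state is
reachable. -/
theorem Reach.zero {w' : V → PUnit.{u + 1}} {R' : ℕ → PUnit.{u + 1}} (h : D.Reach F Fc s w' R')
    (G : Type u) [AddCommGroup G] : D.Reach F Fc s (fun _ => (0 : G)) (fun _ => 0) := by
  induction h with
  | init w hw =>
    have := Reach.init (D := D) (F := F) (fun _ => (0 : G)) (fun _ _ => rfl)
    rwa [Instr.execAll_zero] at this
  | @step Fc s w R h op hop ih =>
    have := ih.step (Op.ofShape op.shape) (by
      rw [← RootedForest.legalOp_shape, Op.shape_ofShape]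
      exact RootedForest.legalOp_shape.2 hop)
    rwa [Op.newWeights_ofShape, Instr.execAll_zero, ← RootedForest.apply_shape, Op.shape_ofShape,
      RootedForest.apply_shape] at this

variable [Fintype V] {G : Type u} [AddCommGroup G] {w : V → G} {R : ℕ → G}

/-- Correctness speaks only of runs from the initialization. Recovering a history of the
configuration makes it applicable in the middle of a run. -/
theorem Reach.exists_prefix (h : D.Reach F Fc s w R) :
    ∃ (w₀ : V → G) (ops : List (Op V G)) (l l' : List G), (∀ v ∈ F.aux, w₀ v = 0) ∧
      F.Legal ops ∧ F.applyAll ops = Fc ∧ l.length = l'.length ∧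
      (∀ rest, D.output w₀ (ops ++ rest) = l ++ D.outputFrom s w R rest) ∧
      ∀ rest, F.answers w₀ (ops ++ rest) = l' ++ Fc.answers w rest := by
  induction h with
  | init w hw => exact ⟨w, [], [], [], hw, trivial, rfl, rfl, fun _ => rfl, fun _ => rfl⟩
  | @step Fc s w R h op hop ih =>
    obtain ⟨w₀, ops, l, l', hw, hops, hF, hl, ho, ha⟩ := ih
    have hleg : F.Legal (ops ++ [op]) := by
      rw [RootedForest.legal_append, hF]
      exact ⟨hops, hop, trivial⟩
    have happ : F.applyAll (ops ++ [op]) = Fc.apply op := by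
      rw [RootedForest.applyAll_append, hF]
      rfl
    cases op with
    | treeSum v =>
      refine ⟨w₀, ops ++ [.treeSum v],
        l ++ [(D.ret s v).read w (Instr.execAll w R (D.prog s (.treeSum v)))],
        l' ++ [Fc.treeSum w v], hw, hleg, happ, by simp [hl], fun rest => ?_, fun rest => ?_⟩
      · rw [List.append_assoc, ho, List.append_assoc]
        rfl
      · rw [List.append_assoc, ha, List.append_assoc]
        rfl
    | cut v =>
      refine ⟨w₀, ops ++ [.cut v], l, l', hw, hleg, happ, hl, fun rest => ?_, fun rest => ?_⟩
      · rw [List.append_assoc, ho]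
        rfl
      · rw [List.append_assoc, ha]
        rfl
    | updateWeight v x =>
      refine ⟨w₀, ops ++ [.updateWeight v x], l, l', hw, hleg, happ, hl, fun rest => ?_,
        fun rest => ?_⟩
      · rw [List.append_assoc, ho]
        rfl
      · rw [List.append_assoc, ha]
        rfl

theorem Reach.ret_read (hD : D.IsTreeSumFor F) (h : D.Reach F Fc s w R) {v : V} (hv : v ∉ Fc.aux) :
    (D.ret s v).read w (Instr.execAll w R (D.prog s (.treeSum v))) = Fc.treeSum w v := by
  obtain ⟨w₀, ops, l, l', hw, hops, hF, hl, ho, ha⟩ := h.exists_prefix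
  have := hD G w₀ hw (ops ++ [.treeSum v]) (by
    rw [RootedForest.legal_append, hF]
    exact ⟨hops, hv, trivial⟩)
  rw [ho, ha] at this
  exact (List.cons.inj (List.append_inj_right this hl)).1

theorem isTreeSumFor_of_invariant {D : DataStructure V} {F : RootedForest V}
    (h : ∀ (G : Type u) [AddCommGroup G],
      ∃ Inv : RootedForest V → D.State → (V → G) → (ℕ → G) → Prop,
        (∀ w, (∀ v ∈ F.aux, w v = 0) → Inv F D.init w (Instr.execAll w (fun _ => 0) D.initProg)) ∧
        (∀ Fc s w R (op : Op V G), Inv Fc s w R → Fc.LegalOp op →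
          Inv (Fc.apply op) (D.next s op.shape) (op.newWeights w)
            (Instr.execAll (op.newWeights w) R (D.prog s op.shape))) ∧
        ∀ Fc s w R v, Inv Fc s w R → v ∉ Fc.aux →
          (D.ret s v).read w (Instr.execAll w R (D.prog s (.treeSum v))) = Fc.treeSum w v) :
    D.IsTreeSumFor F := by
  intro G _ w hw ops hops
  obtain ⟨Inv, hinit, hstep, hret⟩ := h G
  have main : ∀ (ops : List (Op V G)) (Fc : RootedForest V) (s : D.State) (w : V → G) (R : ℕ → G),
      Inv Fc s w R → Fc.Legal ops → D.outputFrom s w R ops = Fc.answers w ops := by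
    intro ops
    induction ops with
    | nil => exact fun _ _ _ _ _ _ => rfl
    | cons op ops ih =>
      intro Fc s w R hI hl
      have := ih _ _ _ _ (hstep Fc s w R op hI hl.1) hl.2
      cases op with
      | treeSum v => exact congrArg₂ List.cons (hret Fc s w R v hI hl.1) this
      | cut v => exact this
      | updateWeight v x => exact this
  exact main ops F _ w _ (hinit w hw) hops

end Correctness

section Cost

variable (D : DataStructure V)

/-- The control state after a sequence of operations. -/
def nextAll (s : D.State) (ops : List (OpShape V)) : D.State := ops.foldl D.next s

theorem nextAll_append (s : D.State) (ops ops' : List (OpShape V)) :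
    D.nextAll s (ops ++ ops') = D.nextAll (D.nextAll s ops) ops' :=
  List.foldl_append

theorem costFrom_append (s : D.State) (ops ops' : List (OpShape V)) :
    D.costFrom s (ops ++ ops') = D.costFrom s ops + D.costFrom (D.nextAll s ops) ops' := by
  induction ops generalizing s with
  | nil => simp [costFrom, nextAll]
  | cons op ops ih =>
    rw [List.cons_append, costFrom, costFrom, ih, add_assoc]
    rfl

variable {D} {F Fc : RootedForest V} {s : D.State}

theorem Reach.step_shape {w : V → PUnit.{u + 1}} {R : ℕ → PUnit.{u + 1}} (h : D.Reach F Fc s w R)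
    (op : OpShape V) (hop : Fc.LegalOp op) : D.Reach F (Fc.apply op) (D.next s op) w R := by
  have := h.step op hop
  rw [Op.shape_shape] at this
  convert this using 1

theorem Reach.nextAll {w : V → PUnit.{u + 1}} {R : ℕ → PUnit.{u + 1}} (h : D.Reach F Fc s w R)
    (ops : List (OpShape V)) (hops : Fc.Legal ops) :
    D.Reach F (Fc.applyAll ops) (D.nextAll s ops) w R := by
  induction ops generalizing Fc s with
  | nil => exact h
  | cons op ops ih => exact ih (h.step_shape op hops.1) hops.2

theorem reach_init (D : DataStructure V) (F : RootedForest V) :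
    D.Reach F F D.init (fun _ => PUnit.unit) (fun _ => PUnit.unit) :=
  Reach.init (fun _ => PUnit.unit) (fun _ _ => rfl)

/-- A shorter sequence is padded with tree sums at `v`, which are always legal and cannot lower the
cost. -/
theorem cost_le_time {m : ℕ} {ops : List (OpShape V)} {v : V} (hv : v ∉ F.aux) (hops : F.Legal ops)
    (hm : ops.length ≤ m) : (D.cost ops : ℕ∞) ≤ D.time F m := by
  set ops' := ops ++ List.replicate (m - ops.length) (.treeSum v : OpShape V)
  have h1 : (D.cost ops : ℕ∞) ≤ D.cost ops' := by
    rw [cost, cost, costFrom_append]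
    exact_mod_cast (by omega)
  refine h1.trans (le_iSup₂_of_le ops' ⟨?_, ?_⟩ le_rfl)
  · rw [RootedForest.legal_append]
    refine ⟨hops, RootedForest.legal_replicate_treeSum ?_ _⟩
    rwa [RootedForest.applyAll_aux]
  · simp only [ops', List.length_append, List.length_replicate]
    omega

theorem time_le {m : ℕ} {c : ℕ∞}
    (h : ∀ ops : List (OpShape V), F.Legal ops → ops.length = m → (D.cost ops : ℕ∞) ≤ c) :
    D.time F m ≤ c :=
  iSup₂_le fun ops hops => h ops hops.1 hops.2

theorem time_mono {m m' : ℕ} {v : V} (hv : v ∉ F.aux) (h : m ≤ m') :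
    D.time F m ≤ D.time F m' :=
  time_le fun _ hops hl => cost_le_time hv hops (hl.le.trans h)

end Cost

end DataStructure

section Opt

variable {V : Type u} [Fintype V] {F : RootedForest V}

theorem OPT_le_time {D : DataStructure V} (hD : D.IsTreeSumFor F) (m : ℕ) : OPT F m ≤ D.time F m :=
  iInf₂_le D hD

theorem OPT_mono {m m' : ℕ} {v : V} (hv : v ∉ F.aux) (h : m ≤ m') : OPT F m ≤ OPT F m' :=
  le_iInf₂ fun _ hD => (OPT_le_time hD m).trans (DataStructure.time_mono hv h)

end Opt

/-! ### Naive upper bounds and a lower bound linear in the number of operations -/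

namespace Instr

variable {V G : Type u}

theorem _root_.Cell.read_update {i : ℕ} {X : Cell V} (hX : X ≠ .reg i) (w : V → G) (R : ℕ → G)
    (g : G) : X.read w (Function.update R i g) = X.read w R := by
  cases X with
  | weight v => rfl
  | reg j =>
    refine Function.update_of_ne ?_ _ _
    rintro rfl
    exact hX rfl

variable [AddCommGroup G]

/-- Store the sum of the cells `X :: Xs` in the register `i`. -/
def sumProg (i : ℕ) (X : Cell V) (Xs : List (Cell V)) : List (Instr V) :=
  copy i X :: Xs.map (add i (.reg i))

theorem costAll_sumProg (i : ℕ) (X : Cell V) (Xs : List (Cell V)) :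
    costAll (sumProg i X Xs) = Xs.length := by
  rw [sumProg, costAll_cons, cost, zero_add]
  induction Xs with
  | nil => rfl
  | cons Y Ys ih =>
    rw [List.map_cons, costAll_cons, ih, cost, List.length_cons, add_comm]

theorem execAll_sumProg {i : ℕ} {X : Cell V} {Xs : List (Cell V)} (h : ∀ Y ∈ Xs, Y ≠ .reg i)
    (w : V → G) (R : ℕ → G) : execAll w R (sumProg i X Xs) =
      Function.update R i (X.read w R + (Xs.map (Cell.read w R)).sum) := by
  rw [sumProg, execAll_cons, exec]
  generalize X.read w R = g
  induction Xs generalizing g with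
  | nil => simp [execAll_nil]
  | cons Y Ys ih =>
    rw [List.map_cons, execAll_cons, exec, Cell.read_update (h Y List.mem_cons_self)]
    have hread : (Cell.reg i : Cell V).read w (Function.update R i g) = g := Function.update_self _ _ _
    rw [hread, Function.update_idem]
    rw [ih (fun Z hZ => h Z (List.mem_cons_of_mem _ hZ)), List.map_cons, List.sum_cons, add_assoc]

/-- Without additions and subtractions, no new values appear in the cells. -/
theorem execAll_read_mem_of_costAll_eq_zero {P : Set G} {w : V → G} {p : List (Instr V)}
    (hp : costAll p = 0) (R : ℕ → G) (h : ∀ X : Cell V, X.read w R ∈ P) (X : Cell V) :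
    X.read w (execAll w R p) ∈ P := by
  induction p generalizing R with
  | nil => exact h X
  | cons c p ih =>
    rw [costAll_cons, Nat.add_eq_zero_iff] at hp
    rw [execAll_cons]
    refine ih hp.2 _ fun Y => ?_
    cases c with
    | add => exact absurd hp.1 one_ne_zero
    | sub => exact absurd hp.1 one_ne_zero
    | copy i Z =>
      by_cases hY : Y = .reg i
      · subst hY
        simp only [exec, Cell.read, Function.update_self]
        exact h Z
      · rw [exec, Cell.read_update hY]
        exact h Y

end Instr

namespace DataStructure

variable {V : Type u}

/-- The data structure that returns the weight of the queried vertex. -/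
def trivial (V : Type u) : DataStructure V where
  State := PUnit
  init := PUnit.unit
  initProg := []
  next _ _ := PUnit.unit
  prog _ _ := []
  ret _ v := .weight v

theorem trivial_time (F : RootedForest V) (m : ℕ) : (trivial V).time F m = 0 := by
  refine le_antisymm (time_le fun ops _ _ => ?_) zero_le
  have : ∀ s, (trivial V).costFrom s ops = 0 := by
    clear * -
    induction ops with
    | nil => exact fun _ => rfl
    | cons op ops ih =>
      intro s
      rw [costFrom, ih]
      rfl
  rw [cost, this]
  rfl

variable [Fintype V]

open Classical in
/-- The data structure that adds up all weights in the current tree. -/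
noncomputable def naive (F : RootedForest V) : DataStructure V where
  State := RootedForest V
  init := F
  initProg := []
  next := RootedForest.apply
  prog
    | Fc, .treeSum v => Instr.sumProg 0 (.weight v)
        (((Finset.univ.filter fun x => Fc.graph.Reachable v x).erase v).toList.map .weight)
    | _, _ => []
  ret _ _ := .reg 0

open Classical in
theorem naive_isTreeSumFor (F : RootedForest V) : (naive F).IsTreeSumFor F := by
  refine isTreeSumFor_of_invariant fun G _ => ⟨fun Fc s _ _ => s = Fc, ?_, ?_, ?_⟩
  · exact fun _ _ => rfl
  · rintro Fc s w R op rfl -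
    exact RootedForest.apply_shape _ _
  · rintro Fc s w R v rfl -
    simp only [naive]
    rw [Instr.execAll_sumProg]
    · simp only [Cell.read, Function.update_self, List.map_map]
      have : Cell.read w R ∘ Cell.weight = w := rfl
      rw [this, Finset.sum_map_toList]
      exact Finset.add_sum_erase _ _ (by simp)
    · intro Y hY
      obtain ⟨x, -, rfl⟩ := List.mem_map.1 hY
      rintro ⟨⟩

theorem naive_time_le (F : RootedForest V) (m : ℕ) :
    (naive F).time F m ≤ (m * Fintype.card V : ℕ) := by
  refine time_le fun ops _ hm => ?_
  have : ∀ (ops : List (OpShape V)) (s : (naive F).State),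
      (naive F).costFrom s ops ≤ ops.length * Fintype.card V := by
    intro ops
    induction ops with
    | nil => exact fun _ => Nat.zero_le _
    | cons op ops ih =>
      intro s
      rw [costFrom, List.length_cons, add_mul, one_mul, add_comm]
      refine add_le_add (ih _) ?_
      cases op with
      | treeSum v =>
        simp only [naive]
        rw [Instr.costAll_sumProg, List.length_map, Finset.length_toList]
        exact Finset.card_le_univ _
      | cut v => exact Nat.zero_le _
      | updateWeight v x => exact Nat.zero_le _
  rw [cost, ← hm, Nat.cast_le]
  change 0 + _ ≤ _
  rw [zero_add]
  exact this ops F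

theorem trivial_isTreeSumFor {F : RootedForest V}
    (hF : ∀ x y, x ∉ F.aux → y ∉ F.aux → F.graph.Reachable x y → x = y) :
    (trivial V).IsTreeSumFor F := by
  classical
  refine isTreeSumFor_of_invariant fun G _ => ⟨fun Fc _ w _ => Fc.aux = F.aux ∧
    (∀ x y, Fc.graph.Reachable x y → F.graph.Reachable x y) ∧ ∀ x ∈ F.aux, w x = 0, ?_, ?_, ?_⟩
  · exact fun w hw => ⟨rfl, fun _ _ => id, hw⟩
  · rintro Fc s w R op ⟨h1, h2, h3⟩ hop
    refine ⟨by rw [RootedForest.apply_aux, h1], ?_, ?_⟩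
    · cases op with
      | cut v => exact fun x y h => h2 x y (RootedForest.cut_reachable_iff.1 h).1
      | treeSum v => exact h2
      | updateWeight v x => exact h2
    · cases op with
      | cut v => exact h3
      | treeSum v => exact h3
      | updateWeight v z =>
        intro x hx
        simp only [Op.newWeights]
        rw [Function.update_of_ne, h3 x hx]
        rintro rfl
        exact hop (h1 ▸ hx)
  · rintro Fc s w R v ⟨h1, h2, h3⟩ hv
    rw [h1] at hv
    simp only [trivial, Cell.read, RootedForest.treeSum]
    rw [Finset.sum_eq_single v]
    · intro y hy hne
      by_contra hw
      refine hne (hF v y hv (fun hy' => hw (h3 y hy')) (h2 v y ?_)).symm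
      simpa using hy
    · simp

section LowerBound

variable {D : DataStructure V} {F Fc : RootedForest V} {s : D.State} {x y : V}

/-- Start over the integers with everything zero and set the weights of `x` and `y` to 1. Copying
alone only ever produces 0 and 1, but the correct answer is 2. -/
theorem one_le_costFrom_update_update_treeSum (hD : D.IsTreeSumFor F) {w : V → PUnit.{u + 1}}
    {R : ℕ → PUnit.{u + 1}} (h : D.Reach F Fc s w R) (hx : x ∉ Fc.aux) (hy : y ∉ Fc.aux)
    (hne : x ≠ y) (hxy : Fc.graph.Reachable x y) :
    1 ≤ D.costFrom s [.updateWeight x PUnit.unit, .updateWeight y PUnit.unit, .treeSum x] := by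
  classical
  by_contra hcost
  simp only [costFrom, not_le, Nat.lt_one_iff, Nat.add_eq_zero_iff] at hcost
  obtain ⟨c1, c2, c3, -⟩ := hcost
  have h0 := h.zero (ULift.{u} ℤ)
  have h1 := h0.step (.updateWeight x 1) hx
  have h2 := h1.step (.updateWeight y 1) hy
  have h3 := h2.ret_read hD hx
  set P : Set (ULift.{u} ℤ) := {0, 1}
  have m1 := Instr.execAll_read_mem_of_costAll_eq_zero (P := P)
    (w := Op.newWeights (fun _ => 0) (.updateWeight x 1)) c1 (fun _ => 0) (by
      rintro (i | z)
      · exact Or.inl rfl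
      · by_cases hz : z = x
        · subst hz
          simp [P, Cell.read, Op.newWeights]
        · simp [P, Cell.read, Op.newWeights, hz])
  have m2 := Instr.execAll_read_mem_of_costAll_eq_zero (P := P)
    (w := Op.newWeights (Op.newWeights (fun _ => 0) (.updateWeight x 1)) (.updateWeight y 1)) c2
    _ (by
      rintro (i | z)
      · exact m1 (.reg i)
      · by_cases hz : z = y
        · subst hz
          simp [P, Cell.read, Op.newWeights]
        · have := m1 (.weight z)
          simpa [P, Cell.read, Op.newWeights, hz] using this)
  have m3 := Instr.execAll_read_mem_of_costAll_eq_zero c3 _ m2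
  have m4 := m3 (D.ret (D.next (D.next s (.updateWeight x PUnit.unit))
    (.updateWeight y PUnit.unit)) x)
  replace m4 := (congrArg (· ∈ P) h3).mp m4
  have hsum : (Fc.treeSum (Op.newWeights (Op.newWeights (fun _ => 0) (.updateWeight x 1))
      (.updateWeight y 1)) x : ULift.{u} ℤ) = 1 + 1 := by
    rw [RootedForest.treeSum, ← Finset.add_sum_erase _ _ (a := x), ← Finset.add_sum_erase _ _ (a := y),
      Finset.sum_eq_zero]
    · simp [Op.newWeights, hne]
    · intro z hz
      simp only [Finset.mem_erase] at hz
      simp [Op.newWeights, hz.1, hz.2.1]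
    · simpa [hne.symm] using hxy
    · simp
  replace m4 := (congrArg (· ∈ P) hsum).mp m4
  rcases m4 with m4 | m4
  · exact absurd (congrArg ULift.down m4) (by decide)
  · exact absurd (congrArg ULift.down m4) (by decide)

theorem exists_costFrom_ge (hD : D.IsTreeSumFor F) {w : V → PUnit.{u + 1}}
    {R : ℕ → PUnit.{u + 1}} (h : D.Reach F Fc s w R) (hx : x ∉ Fc.aux) (hy : y ∉ Fc.aux)
    (hne : x ≠ y) (hxy : Fc.graph.Reachable x y) (c : ℕ) :
    ∃ ops : List (OpShape V), Fc.Legal ops ∧ ops.length = 3 * c ∧ c ≤ D.costFrom s ops := by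
  induction c generalizing s with
  | zero => exact ⟨[], True.intro, rfl, Nat.zero_le _⟩
  | succ c ih =>
    set l : List (OpShape V) := [.updateWeight x PUnit.unit, .updateWeight y PUnit.unit, .treeSum x]
    have hl : Fc.Legal l := ⟨hx, hy, hx, True.intro⟩
    obtain ⟨ops, h1, h2, h3⟩ := ih (h.nextAll l hl)
    refine ⟨l ++ ops, RootedForest.legal_append.2 ⟨hl, h1⟩, ?_, ?_⟩
    · rw [List.length_append, h2]
      simp only [l, List.length_cons, List.length_nil]
      ring
    · rw [costFrom_append]
      have : 1 ≤ D.costFrom s l := one_le_costFrom_update_update_treeSum hD h hx hy hne hxy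
      omega

end LowerBound

end DataStructure

section Opt

open DataStructure

variable {V : Type u} [Fintype V] {F : RootedForest V}

theorem OPT_le_mul_card (F : RootedForest V) (m : ℕ) : OPT F m ≤ (m * Fintype.card V : ℕ) :=
  (OPT_le_time (naive_isTreeSumFor F) m).trans (naive_time_le F m)

theorem exists_time_eq_OPT (F : RootedForest V) (m : ℕ) :
    ∃ D : DataStructure V, D.IsTreeSumFor F ∧ D.time F m = OPT F m := by
  have : Nonempty {D : DataStructure V // D.IsTreeSumFor F} := ⟨⟨_, naive_isTreeSumFor F⟩⟩
  obtain ⟨⟨D, hD⟩, h⟩ := ciInf_mem fun D : {D : DataStructure V // D.IsTreeSumFor F} => D.1.time F m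
  refine ⟨D, hD, h.trans ?_⟩
  rw [OPT, iInf_subtype]
  rfl

theorem OPT_eq_zero (hF : ∀ x y, x ∉ F.aux → y ∉ F.aux → F.graph.Reachable x y → x = y) (m : ℕ) :
    OPT F m = 0 :=
  le_antisymm ((OPT_le_time (trivial_isTreeSumFor hF) m).trans (trivial_time F m).le) zero_le

theorem le_three_mul_OPT_add_two {x y : V} (hx : x ∉ F.aux) (hy : y ∉ F.aux) (hne : x ≠ y)
    (hxy : F.graph.Reachable x y) (m : ℕ) : (m : ℕ∞) ≤ 3 * OPT F m + 2 := by
  obtain ⟨D, hD, h⟩ := exists_time_eq_OPT F m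
  obtain ⟨ops, h1, h2, h3⟩ := exists_costFrom_ge hD (reach_init D F) hx hy hne hxy (m / 3)
  have h4 : ((m / 3 : ℕ) : ℕ∞) ≤ OPT F m := by
    rw [← h]
    refine le_trans ?_ (cost_le_time hx h1 (m := m) (by omega))
    rw [Nat.cast_le, cost]
    omega
  calc (m : ℕ∞) ≤ ((3 * (m / 3) + 2 : ℕ) : ℕ∞) := by
        rw [Nat.cast_le]
        omega
    _ ≤ 3 * OPT F m + 2 := by
        push_cast
        gcongr

/-- Some sequence of operations costs at least the optimum. -/
theorem exists_OPT_le_cost {D : DataStructure V} (hD : D.IsTreeSumFor F) {v : V} (hv : v ∉ F.aux)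
    (m : ℕ) : ∃ ops : List (OpShape V), F.Legal ops ∧ ops.length = m ∧ OPT F m ≤ D.cost ops := by
  by_contra! h
  obtain ⟨c, hc⟩ := ENat.ne_top_iff_exists.1
    ((OPT_le_mul_card F m).trans_lt (ENat.natCast_lt_top _)).ne
  have hpos : (D.cost (List.replicate m (.treeSum v)) : ℕ∞) < c :=
    hc ▸ h _ (RootedForest.legal_replicate_treeSum hv m) List.length_replicate
  rw [Nat.cast_lt] at hpos
  have : D.time F m ≤ (c - 1 : ℕ) := by
    refine time_le fun ops h1 h2 => ?_
    have := h ops h1 h2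
    rw [← hc, Nat.cast_lt] at this
    rw [Nat.cast_le]
    omega
  have h' := (OPT_le_time hD m).trans this
  rw [← hc, Nat.cast_le] at h'
  omega

end Opt

/-! ### Renaming registers and switching data structures between operations -/

/-- Rename registers along `f` and replace the weights by other cells. -/
def Cell.map {V W : Type u} (f : ℕ → ℕ) (g : V → Cell W) : Cell V → Cell W
  | reg i => reg (f i)
  | weight v => g v

namespace Instr

variable {V W : Type u}

/-- Rename registers along `f` and replace the weights by other cells. -/
def map (f : ℕ → ℕ) (g : V → Cell W) : Instr V → Instr W
  | copy i X => copy (f i) (X.map f g)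
  | add i X Y => add (f i) (X.map f g) (Y.map f g)
  | sub i X Y => sub (f i) (X.map f g) (Y.map f g)

theorem costAll_map (f : ℕ → ℕ) (g : V → Cell W) (p : List (Instr V)) :
    costAll (p.map (map f g)) = costAll p := by
  rw [costAll, List.map_map, costAll]
  congr 1
  refine List.map_congr_left fun c _ => ?_
  cases c <;> rfl

variable {G : Type u} {f : ℕ → ℕ} {g : V → Cell W} {w : V → G} {w' : W → G}

theorem _root_.Cell.read_map {R : ℕ → G} (hw : ∀ v, (g v).read w' R = w v) (X : Cell V) :
    (X.map f g).read w' R = X.read w (fun i => R (f i)) := by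
  cases X with
  | reg i => rfl
  | weight v => exact hw v

variable [AddCommGroup G]

theorem execAll_map_of_notMem_range (p : List (Instr V)) (R : ℕ → G) {j : ℕ} (hj : ∀ i, f i ≠ j) :
    execAll w' R (p.map (map f g)) j = R j := by
  induction p generalizing R with
  | nil => rfl
  | cons c p ih =>
    rw [List.map_cons, execAll_cons, ih]
    cases c <;> exact Function.update_of_ne (hj _).symm _ _

theorem execAll_map (hf : f.Injective) (hg : ∀ v i, g v ≠ .reg (f i)) (p : List (Instr V))
    (R : ℕ → G) (hw : ∀ v, (g v).read w' R = w v) :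
    (fun i => execAll w' R (p.map (map f g)) (f i)) = execAll w (fun i => R (f i)) p := by
  induction p generalizing R with
  | nil => rfl
  | cons c p ih =>
    have key : ∀ (i : ℕ) (x : G), (fun j => Function.update R (f i) x (f j)) =
        Function.update (fun j => R (f j)) i x :=
      fun i x => Function.update_comp_eq_of_injective R hf i x
    rw [List.map_cons, execAll_cons, execAll_cons, ih]
    · congr 1
      cases c <;> simp only [map, exec, Cell.read_map hw, key]
    · intro v
      cases c <;> simp only [map, exec] <;> rw [Cell.read_update (hg v _), hw]

end Instr

namespace DataStructure

variable {V : Type u}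

theorem Reach.weight_eq_zero {D : DataStructure V} {F Fc : RootedForest V} {s : D.State}
    {G : Type u} [AddCommGroup G] {w : V → G} {R : ℕ → G} (h : D.Reach F Fc s w R) :
    ∀ v ∈ Fc.aux, w v = 0 := by
  classical
  induction h with
  | init w hw => exact hw
  | @step Fc s w R h op hop ih =>
    rw [RootedForest.apply_aux]
    cases op with
    | cut v => exact ih
    | treeSum v => exact ih
    | updateWeight v z =>
      intro x hx
      simp only [Op.newWeights]
      rw [Function.update_of_ne, ih x hx]
      rintro rfl
      exact hop hx

/-- Use `A` for the first `a + 1` operations, and then the structure that `B` provides for the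
current forest. -/
noncomputable def switch (A : DataStructure V) (B : RootedForest V → DataStructure V)
    (F : RootedForest V) (a : ℕ) : DataStructure V where
  State := (ℕ × RootedForest V × A.State) ⊕ (Σ F', (B F').State)
  init := .inl (a, F, A.init)
  -- `A` owns the even registers, the structures `B F'` own the odd ones.
  initProg := A.initProg.map (Instr.map (fun i => 2 * i) .weight)
  next
    | .inl (0, Fc, _), op => .inr ⟨Fc.apply op, (B (Fc.apply op)).init⟩
    | .inl (c + 1, Fc, s), op => .inl (c, Fc.apply op, A.next s op)
    | .inr ⟨F', s⟩, op => .inr ⟨F', (B F').next s op⟩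
  prog
    -- The counter starts at `a`, so 0 marks operation number `a + 1`, the last one of `A`. The
    -- initialization of the next structure runs at the end of this operation.
    | .inl (0, Fc, s), op => (A.prog s op).map (Instr.map (fun i => 2 * i) .weight) ++
        (B (Fc.apply op)).initProg.map (Instr.map (fun i => 2 * i + 1) .weight)
    | .inl (_ + 1, _, s), op => (A.prog s op).map (Instr.map (fun i => 2 * i) .weight)
    | .inr ⟨F', s⟩, op => ((B F').prog s op).map (Instr.map (fun i => 2 * i + 1) .weight)
  ret
    | .inl (_, _, s), v => (A.ret s v).map (fun i => 2 * i) .weight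
    | .inr ⟨F', s⟩, v => ((B F').ret s v).map (fun i => 2 * i + 1) .weight

section Switch

variable {A : DataStructure V} {B : RootedForest V → DataStructure V} {F : RootedForest V}

theorem switch_isTreeSumFor [Fintype V] (hA : A.IsTreeSumFor F) (hB : ∀ F', (B F').IsTreeSumFor F')
    (a : ℕ) : (switch A B F a).IsTreeSumFor F := by
  have he : Function.Injective fun i : ℕ => 2 * i := fun i j h => by
    simp only at h
    omega
  have ho : Function.Injective fun i : ℕ => 2 * i + 1 := fun i j h => by
    simp only at h
    omega
  have hg : ∀ (f : ℕ → ℕ) (v : V) (i : ℕ), (Cell.weight v : Cell V) ≠ .reg (f i) :=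
    fun _ _ _ h => by cases h
  have hE : ∀ {G : Type u} [AddCommGroup G] (w : V → G) (p : List (Instr V)) (R : ℕ → G),
      (fun i => Instr.execAll w R (p.map (Instr.map (fun i => 2 * i) .weight)) (2 * i)) =
        Instr.execAll w (fun i => R (2 * i)) p :=
    fun w p R => Instr.execAll_map (w := w) he (hg _) p R fun _ => rfl
  have hO : ∀ {G : Type u} [AddCommGroup G] (w : V → G) (p : List (Instr V)) (R : ℕ → G),
      (fun i => Instr.execAll w R (p.map (Instr.map (fun i => 2 * i + 1) .weight)) (2 * i + 1)) =
        Instr.execAll w (fun i => R (2 * i + 1)) p :=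
    fun w p R => Instr.execAll_map (w := w) ho (hg _) p R fun _ => rfl
  have hE' : ∀ {G : Type u} [AddCommGroup G] (w : V → G) (p : List (Instr V)) (R : ℕ → G) (i : ℕ),
      Instr.execAll w R (p.map (Instr.map (fun i => 2 * i) .weight)) (2 * i + 1) = R (2 * i + 1) :=
    fun w p R i => Instr.execAll_map_of_notMem_range p R fun j => by omega
  have hO' : ∀ {G : Type u} [AddCommGroup G] (w : V → G) (p : List (Instr V)) (R : ℕ → G) (i : ℕ),
      Instr.execAll w R (p.map (Instr.map (fun i => 2 * i + 1) .weight)) (2 * i) = R (2 * i) :=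
    fun w p R i => Instr.execAll_map_of_notMem_range p R fun j => by omega
  -- While `A` is running the odd registers stay zero, as the initialization of its successor
  -- requires.
  refine isTreeSumFor_of_invariant fun G _ => ⟨fun Fc s w R => match s with
    | .inl (_, F', s) => F' = Fc ∧ A.Reach F Fc s w (fun i => R (2 * i)) ∧ ∀ i, R (2 * i + 1) = 0
    | .inr ⟨F', s⟩ => (B F').Reach F' Fc s w (fun i => R (2 * i + 1)), ?_, ?_, ?_⟩
  · intro w hw
    refine ⟨rfl, ?_, hE' w _ _⟩
    have := Reach.init (D := A) w hw
    rwa [← hE w A.initProg (fun _ => 0)] at this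
  · rintro Fc (⟨_ | c, F', s⟩ | ⟨F', s⟩) w R op hI hop
    · obtain ⟨rfl, h1, h2⟩ := hI
      have h3 := h1.step op hop
      have h4 := Reach.init (D := B (F'.apply op)) (F := F'.apply op) _ h3.weight_eq_zero
      have h5 : (fun _ => (0 : G)) = fun i => Instr.execAll (op.newWeights w) R
          ((A.prog s op.shape).map (Instr.map (fun i => 2 * i) .weight)) (2 * i + 1) :=
        funext fun i => ((hE' _ _ _ _).trans (h2 i)).symm
      rw [h5, ← hO] at h4
      simp only [switch]
      rw [RootedForest.apply_shape, Instr.execAll_append]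
      exact h4
    · obtain ⟨rfl, h1, h2⟩ := hI
      have h3 := h1.step op hop
      refine ⟨RootedForest.apply_shape _ _, ?_, fun i => (hE' _ _ _ _).trans (h2 i)⟩
      rwa [← hE] at h3
    · have h3 := Reach.step hI op hop
      rw [← hO] at h3
      exact h3
  · rintro Fc (⟨_ | c, F', s⟩ | ⟨F', s⟩) w R v hI hv
    -- The last answer of `A` is read only after the initialization of its successor, which does not
    -- touch even registers.
    · obtain ⟨rfl, h1, h2⟩ := hI
      rw [← h1.ret_read hA hv, ← hE]
      simp only [switch]
      rw [Cell.read_map (w := w) (fun _ => rfl), Instr.execAll_append]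
      simp only [hO']
    · obtain ⟨rfl, h1, h2⟩ := hI
      rw [← h1.ret_read hA hv, ← hE]
      exact Cell.read_map (fun _ => rfl) _
    · rw [← Reach.ret_read (hB F') hI hv, ← hO]
      exact Cell.read_map (fun _ => rfl) _

theorem costFrom_switch_inr (a : ℕ) (F' : RootedForest V) (s : (B F').State)
    (ops : List (OpShape V)) :
    (switch A B F a).costFrom (.inr ⟨F', s⟩) ops = (B F').costFrom s ops := by
  induction ops generalizing s with
  | nil => rfl
  | cons op ops ih =>
    exact congrArg₂ (· + ·) (Instr.costAll_map _ _ _) (ih _)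

theorem costFrom_switch_inl (a c : ℕ) (Fc : RootedForest V) (s : A.State) (ops : List (OpShape V))
    (h : c < ops.length) : (switch A B F a).costFrom (.inl (c, Fc, s)) ops =
      A.costFrom s (ops.take (c + 1)) +
        (B (Fc.applyAll (ops.take (c + 1)))).cost (ops.drop (c + 1)) := by
  induction c generalizing Fc s ops with
  | zero =>
    obtain _ | ⟨op, ops⟩ := ops
    · cases h
    · refine (congrArg₂ (· + ·) (Instr.costAll_append _ _)
        (costFrom_switch_inr a (Fc.apply op) _ ops)).trans ?_
      rw [Instr.costAll_map, Instr.costAll_map, add_assoc]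
      simp [costFrom, cost, RootedForest.applyAll]
  | succ c ih =>
    obtain _ | ⟨op, ops⟩ := ops
    · cases h
    · refine (congrArg₂ (· + ·) (Instr.costAll_map _ _ _)
        (ih (Fc.apply op) (A.next s op) ops (by simpa using h))).trans ?_
      rw [← add_assoc]
      rfl

end Switch

end DataStructure

open DataStructure in
-- Run an optimal structure for `F` during the first `a` operations, then switch to an optimal one
-- for the forest reached, whichever it is.
theorem OPT_add_le {V : Type u} [Fintype V] {F : RootedForest V} {a b : ℕ} (ha : 0 < a) {c : ℕ∞}
    (h : ∀ ops : List (OpShape V), F.Legal ops → OPT (F.applyAll ops) b ≤ c) :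
    OPT F (a + b) ≤ OPT F a + c := by
  obtain ⟨A, hA, hA'⟩ := exists_time_eq_OPT F a
  choose B hB hB' using fun F' : RootedForest V => exists_time_eq_OPT F' b
  obtain ⟨a, rfl⟩ := Nat.exists_eq_succ_of_ne_zero ha.ne'
  refine (OPT_le_time (switch_isTreeSumFor hA hB a) _).trans (time_le fun ops hops hl => ?_)
  have hcost : (switch A B F a).cost ops = A.cost (ops.take (a + 1)) +
      (B (F.applyAll (ops.take (a + 1)))).cost (ops.drop (a + 1)) := by
    rw [cost]
    refine (congrArg₂ (· + ·) (Instr.costAll_map _ _ _)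
      (costFrom_switch_inl a a F A.init ops (by omega))).trans ?_
    rw [← add_assoc]
    rfl
  have hops' := hops
  rw [← List.take_append_drop (a + 1) ops, RootedForest.legal_append] at hops'
  rw [hcost, Nat.cast_add]
  refine add_le_add ?_ ?_
  · rw [← hA']
    refine le_iSup₂_of_le (ops.take (a + 1)) ⟨hops'.1, ?_⟩ le_rfl
    rw [List.length_take]
    omega
  · refine le_trans ?_ (h _ hops'.1)
    rw [← hB']
    refine le_iSup₂_of_le (ops.drop (a + 1)) ⟨hops'.2, ?_⟩ le_rfl
    rw [List.length_drop]
    omega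

/-! ### Coupled forests and lazy cuts -/

namespace RootedForest

variable {V W : Type u}

/-- The forest `H` embeds into `F` along `ι`, and distinct trees of `H` that consist of active
vertices (those in `A`) lie in distinct trees of `F`. Inactive trees can be separated from the
active ones by cutting edges of `F` above roots of `H`. -/
structure Coupled (ι : W → V) (H : RootedForest W) (F : RootedForest V) (A : Set W) : Prop where
  parent : ∀ x p, H.parent x = some p → F.parent (ι x) = some (ι p)
  aux : ∀ x, ι x ∈ F.aux ↔ x ∈ H.aux
  closed : ∀ x y, x ∈ A → H.graph.Reachable x y → y ∈ A
  sep : ∀ x y, x ∈ A → y ∈ A → F.graph.Reachable (ι x) (ι y) → H.graph.Reachable x y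
  notMem_aux : (∀ x, x ∈ A) ∨ ∀ z, H.parent z = none → F.parent (ι z) ≠ none → z ∉ H.aux

namespace Coupled

variable {ι : W → V} {H : RootedForest W} {F : RootedForest V} {A : Set W} {x y v : W}

theorem anc (hc : Coupled ι H F A) (h : H.Anc x y) : F.Anc (ι x) (ι y) := by
  induction h using Relation.ReflTransGen.head_induction_on with
  | refl => exact Anc.refl _
  | head h _ ih => exact ih.head (hc.parent _ _ h)

/-- Paths to ancestors are unique: the path of `H` from `x` to `y` maps onto the path of `F`, so it
passes through every vertex in between. -/
theorem anc_of_between (hc : Coupled ι H F A) (hι : ι.Injective) (h : H.Anc x y)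
    (hxv : F.Anc (ι x) (ι v)) (hvy : F.Anc (ι v) (ι y)) : H.Anc x v := by
  induction h using Relation.ReflTransGen.head_induction_on with
  | refl =>
    rw [hι (hxv.antisymm hvy)]
    exact Anc.refl _
  | @head x p h _ ih =>
    by_cases hne : ι x = ι v
    · rw [hι hne]
      exact Anc.refl _
    · exact (ih (hxv.of_parent_eq (hc.parent _ _ h) hne)).head h

theorem anc_iff (hc : Coupled ι H F A) (hι : ι.Injective) (h : H.graph.Reachable x v) :
    F.Anc (ι x) (ι v) ↔ H.Anc x v := by
  refine ⟨fun h' => ?_, hc.anc⟩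
  obtain ⟨a, hx, hv⟩ := reachable_iff.1 h
  exact hc.anc_of_between hι hx h' (hc.anc hv)

theorem cut (hc : Coupled ι H F A) (hι : ι.Injective) (hv : v ∉ H.aux) :
    Coupled ι (H.cut v) (F.cut (ι v)) A where
  parent x p h := by
    have hne : x ≠ v := by
      rintro rfl
      rw [cut_parent_self] at h
      cases h
    rw [cut_parent_of_ne hne] at h
    rw [cut_parent_of_ne (hι.ne hne)]
    exact hc.parent x p h
  aux := hc.aux
  closed x y hx h := hc.closed x y hx (cut_reachable_iff.1 h).1
  sep x y hx hy h := by
    rw [cut_reachable_iff] at h ⊢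
    have hxy := hc.sep x y hx hy h.1
    refine ⟨hxy, ?_⟩
    by_cases hxv : H.graph.Reachable x v
    · rw [← hc.anc_iff hι hxv, ← hc.anc_iff hι (hxy.symm.trans hxv)]
      exact h.2
    · exact ⟨fun h => absurd h.reachable hxv, fun h => absurd (hxy.trans h.reachable) hxv⟩
  notMem_aux := by
    refine hc.notMem_aux.imp_right fun hn z hz hz' => ?_
    by_cases hne : z = v
    · exact hne ▸ hv
    · rw [cut_parent_of_ne hne] at hz
      rw [cut_parent_of_ne (hι.ne hne)] at hz'
      exact hn z hz hz'

/-- The edge of `F` above a root of `H` is not an edge of `H`, so removing it on the side of `F`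
alone is harmless. Lazy cuts are of this kind. -/
theorem cut_root (hc : Coupled ι H F A) (hι : ι.Injective) {z : W} (hz : H.parent z = none) :
    Coupled ι H (F.cut (ι z)) A where
  parent x p h := by
    rw [cut_parent_of_ne]
    · exact hc.parent x p h
    · refine hι.ne ?_
      rintro rfl
      rw [hz] at h
      cases h
  aux := hc.aux
  closed := hc.closed
  sep x y hx hy h := hc.sep x y hx hy (cut_reachable_iff.1 h).1
  notMem_aux := by
    refine hc.notMem_aux.imp_right fun hn y hy hy' => hn y hy fun h => hy' ?_
    by_cases hne : ι y = ι z
    · rw [hne]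
      exact cut_parent_self
    · rw [cut_parent_of_ne hne, h]

theorem union (hc : Coupled ι H F A) (hv : ∀ a ∈ A, ¬ F.graph.Reachable (ι v) (ι a)) :
    Coupled ι H F (A ∪ {x | H.graph.Reachable v x}) where
  parent := hc.parent
  aux := hc.aux
  closed x y hx h := by
    rcases hx with hx | hx
    · exact Or.inl (hc.closed x y hx h)
    · exact Or.inr (SimpleGraph.Reachable.trans hx h)
  sep x y hx hy h := by
    have key : ∀ x, H.graph.Reachable v x → F.graph.Reachable (ι v) (ι x) := by
      intro x hx
      obtain ⟨a, h1, h2⟩ := reachable_iff.1 hx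
      exact reachable_iff.2 ⟨ι a, hc.anc h1, hc.anc h2⟩
    rcases hx with hx | hx <;> rcases hy with hy | hy
    · exact hc.sep x y hx hy h
    · exact absurd ((key y hy).trans h.symm) (hv x hx)
    · exact absurd ((key x hx).trans h) (hv y hy)
    · exact SimpleGraph.Reachable.trans (SimpleGraph.Reachable.symm hx) hy
  notMem_aux := hc.notMem_aux.imp_left fun h x => Or.inl (h x)

/-- Every vertex can be made active by at most one cut. -/
theorem exists_activate (hc : Coupled ι H F A) (hι : ι.Injective) (v : W) :
    ∃ (l : List (OpShape V)) (A' : Set W), l.length ≤ 1 ∧ (∀ o ∈ l, ∃ z, o = .cut (ι z)) ∧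
      F.Legal l ∧ A ⊆ A' ∧ v ∈ A' ∧ Coupled ι H (F.applyAll l) A' := by
  by_cases hv : v ∈ A
  · exact ⟨[], A, Nat.zero_le _, by simp, True.intro, subset_rfl, hv, hc⟩
  have hvA : v ∈ A ∪ {x | H.graph.Reachable v x} := Or.inr (SimpleGraph.Reachable.refl _)
  by_cases hcon : ∀ a ∈ A, ¬ F.graph.Reachable (ι v) (ι a)
  · exact ⟨[], _, Nat.zero_le _, by simp, True.intro, Set.subset_union_left, hvA, hc.union hcon⟩
  push Not at hcon
  obtain ⟨a, ha, hva⟩ := hcon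
  have hn := hc.notMem_aux.resolve_left fun h => hv (h v)
  obtain ⟨k, hvk, hk⟩ := H.exists_root v
  obtain ⟨k', hak, hk'⟩ := H.exists_root a
  have hne : k ≠ k' := by
    rintro rfl
    exact hv (hc.closed a v ha (reachable_iff.2 ⟨k, hak, hvk⟩))
  -- By `sep`, only one active tree of `H` meets the tree of `ι v`. Its root `k'` is above every
  -- active vertex that has to be separated from `v`.
  have hAk : ∀ b ∈ A, F.graph.Reachable (ι v) (ι b) → H.Anc b k' := fun b hb h =>
    (reachable_iff_anc_root hak hk').1 (hc.sep a b ha hb (hva.symm.trans h))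
  suffices ∃ z, H.parent z = none ∧ F.parent (ι z) ≠ none ∧
      ∀ b ∈ A, ¬ (F.cut (ι z)).graph.Reachable (ι v) (ι b) by
    obtain ⟨z, hz, hz', hsep⟩ := this
    refine ⟨[.cut (ι z)], _, le_rfl, by simp, ⟨⟨?_, hz'⟩, True.intro⟩, Set.subset_union_left, hvA,
      (hc.cut_root hι hz).union hsep⟩
    rw [hc.aux]
    exact hn z hz hz'
  -- If `ι k'` lies below `ι k`, cutting above `ι k'` splits off the active vertices and leaves `v`
  -- behind. Otherwise cutting above `ι k` splits off `v` and leaves the active vertices behind. Any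
  -- violation would put one of the two roots inside the other tree of `H`.
  by_cases hkk : F.Anc (ι k') (ι k)
  · refine ⟨k', hk', fun h => hne (hι (hkk.eq_of_root h)).symm, fun b hb h => ?_⟩
    rw [cut_reachable_iff] at h
    have h1 := h.2.2 (hc.anc (hAk b hb h.1))
    have h2 := hc.anc_of_between hι hvk h1 hkk
    exact hne ((h2.of_root hvk hk).eq_of_root hk').symm
  · refine ⟨k, hk, fun h => ?_, fun b hb h => ?_⟩
    · have h1 := (reachable_iff_anc_root (hc.anc hvk) h).1 hva
      rcases h1.comparable (hc.anc hak) with h2 | h2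
      · exact hne (hι (h2.eq_of_root h))
      · exact hkk h2
    · rw [cut_reachable_iff] at h
      have h1 := h.2.1 (hc.anc hvk)
      have h2 := hAk b hb h.1
      rcases h1.comparable (hc.anc h2) with h3 | h3
      · have h4 := hc.anc_of_between hι h2 h1 h3
        exact hne ((h4.of_root h2 hk').eq_of_root hk)
      · exact hkk h3

end Coupled

theorem applyAll_parent_of_forall {F : RootedForest V} {ι : W → V} {l : List (OpShape V)} {z : V}
    (hl : ∀ o ∈ l, ∀ v, o = .cut v → v ∈ Set.range ι) (hz : z ∉ Set.range ι) :
    (F.applyAll l).parent z = F.parent z := by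
  induction l generalizing F with
  | nil => rfl
  | cons o l ih =>
    rw [applyAll_cons, ih fun o ho => hl o (List.mem_cons_of_mem _ ho)]
    cases o with
    | treeSum v => rfl
    | updateWeight v x => rfl
    | cut v =>
      refine cut_parent_of_ne ?_
      rintro rfl
      exact hz (hl _ List.mem_cons_self _ rfl)

end RootedForest

/-! ### Precomputed subtree sums and the register layout -/

namespace Instr

variable {W G : Type u} [AddCommGroup G]

theorem execAll_copy_weight {f : W → ℕ} (hf : f.Injective) (l : List W) (w : W → G) (R : ℕ → G) :
    (∀ x ∈ l, execAll w R (l.map fun x => copy (f x) (.weight x)) (f x) = w x) ∧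
      ∀ j, (∀ x, f x ≠ j) → execAll w R (l.map fun x => copy (f x) (.weight x)) j = R j := by
  induction l using List.reverseRecOn with
  | nil => exact ⟨by simp, fun _ _ => rfl⟩
  | append_singleton l y ih =>
    rw [List.map_append, execAll_append]
    refine ⟨fun x hx => ?_, fun j hj => ?_⟩
    · by_cases hxy : x = y
      · subst hxy
        exact Function.update_self _ _ _
      · refine (Function.update_of_ne (hf.ne hxy) _ _).trans (ih.1 x ?_)
        simpa [hxy] using hx
    · exact (Function.update_of_ne (hj y).symm _ _).trans (ih.2 j hj)

theorem costAll_copy_weight (f : W → ℕ) (l : List W) :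
    costAll (l.map fun x => copy (f x) (.weight x)) = 0 := by
  induction l with
  | nil => rfl
  | cons x l ih => rw [List.map_cons, costAll_cons, ih, cost]

end Instr

open Classical in
/-- The sums below all vertices of a forest can be computed with few additions. -/
theorem RootedForest.exists_descSum_prog {W : Type u} [Fintype W] (H : RootedForest W) {σ : W → ℕ}
    (hσ : σ.Injective) : ∃ p : List (Instr W), Instr.costAll p ≤ Fintype.card W ∧
      ∀ (G : Type u) [AddCommGroup G] (w : W → G) (R : ℕ → G),
        (∀ y, Instr.execAll w R p (σ y) = H.descSum w y) ∧
          ∀ j, (∀ y, σ y ≠ j) → Instr.execAll w R p j = R j := by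
  suffices ∀ P : Finset W, (∀ c p, H.parent c = some p → p ∈ P → c ∈ P) →
      ∃ p : List (Instr W),
        -- One addition per edge whose upper end lies in `P`.
        Instr.costAll p ≤ (Finset.univ.filter fun c => ∃ y ∈ P, H.parent c = some y).card ∧
        ∀ (G : Type u) [AddCommGroup G] (w : W → G) (R : ℕ → G),
          (∀ y ∈ P, Instr.execAll w R p (σ y) = H.descSum w y) ∧
            ∀ j, (∀ y, σ y ≠ j) → Instr.execAll w R p j = R j by
    obtain ⟨p, h1, h2⟩ := this Finset.univ (by simp)
    exact ⟨p, h1.trans (Finset.card_le_univ _), fun G _ w R =>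
      ⟨fun y => (h2 G w R).1 y (Finset.mem_univ y), (h2 G w R).2⟩⟩
  intro P
  induction P using Finset.strongInduction with
  | H P ih =>
    intro hP
    obtain rfl | hne := P.eq_empty_or_nonempty
    · exact ⟨[], Nat.zero_le _, fun G _ w R => ⟨by simp, fun _ _ => rfl⟩⟩
    -- With `y` topmost in `P`, the rest of `P` is still closed under children and contains all
    -- children of `y`, so their sums are available when the sum at `y` is formed.
    obtain ⟨y, hy, hmin⟩ := H.wf.has_min (P : Set W) hne
    have hy : y ∈ P := hy
    have hchild : ∀ c, H.parent c = some y → c ∈ P.erase y := fun c hc => by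
      refine Finset.mem_erase.2 ⟨?_, hP c y hc hy⟩
      rintro rfl
      exact not_anc_of_parent hc (Anc.refl _)
    obtain ⟨p, h1, h2⟩ := ih (P.erase y) (Finset.erase_ssubset hy) fun c q hc hq => by
      refine Finset.mem_erase.2 ⟨?_, hP c q hc (Finset.mem_of_mem_erase hq)⟩
      rintro rfl
      exact hmin q (Finset.mem_of_mem_erase hq) hc
    set ch := (Finset.univ.filter fun c => H.parent c = some y)
    refine ⟨p ++ Instr.sumProg (σ y) (.weight y) (ch.toList.map fun c => .reg (σ c)), ?_,
      fun G _ w R => ?_⟩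
    · rw [Instr.costAll_append, Instr.costAll_sumProg, List.length_map, Finset.length_toList]
      refine (add_le_add_left h1 _).trans ?_
      rw [← Finset.card_union_of_disjoint]
      · refine Finset.card_le_card fun c hc => ?_
        simp only [ch, Finset.mem_union, Finset.mem_filter, Finset.mem_univ, true_and,
          Finset.mem_erase] at hc ⊢
        rcases hc with ⟨z, ⟨_, hz⟩, hc⟩ | hc
        · exact ⟨z, hz, hc⟩
        · exact ⟨y, hy, hc⟩
      · rw [Finset.disjoint_left]
        simp only [ch, Finset.mem_filter, Finset.mem_univ, true_and, Finset.mem_erase]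
        rintro c ⟨z, ⟨hz, _⟩, hc⟩ hc'
        rw [hc, Option.some.injEq] at hc'
        exact hz hc'
    · have hcells : ∀ Y ∈ ch.toList.map fun c => (Cell.reg (σ c) : Cell W), Y ≠ .reg (σ y) := by
        intro Y hY
        obtain ⟨c, hc, rfl⟩ := List.mem_map.1 hY
        simp only [ch, Finset.mem_toList, Finset.mem_filter, Finset.mem_univ, true_and] at hc
        rw [Ne, Cell.reg.injEq]
        exact fun h => (Finset.mem_erase.1 (hchild c hc)).1 (hσ h)
      obtain ⟨h3, h4⟩ := h2 G w R
      rw [Instr.execAll_append, Instr.execAll_sumProg hcells]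
      refine ⟨fun z hz => ?_, fun j hj => ?_⟩
      · by_cases hzy : z = y
        · subst hzy
          rw [Function.update_self, descSum_eq_add_children, List.map_map, Finset.sum_map_toList]
          congr 1
          refine Finset.sum_congr rfl fun c hc => ?_
          simp only [Finset.mem_filter, Finset.mem_univ, true_and] at hc
          exact h3 c (hchild c hc)
        · rw [Function.update_of_ne (hσ.ne hzy)]
          exact h3 z (Finset.mem_erase.2 ⟨hzy, hz⟩)
      · rw [Function.update_of_ne (hj y).symm]
        exact h4 j hj

/-- The roles of the registers in a simulation of a data structure on `V` by one on `W`. -/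
inductive Slot (V W : Type u) where
  | reg (i : ℕ)
  | wt (z : V)
  | err (x : W)
  | sum (x : W)
  | res

theorem Slot.exists_injective (V W : Type u) [Finite V] [Finite W] :
    ∃ e : Slot V W → ℕ, e.Injective := by
  let f : Slot V W → ℕ ⊕ V ⊕ W ⊕ W ⊕ Unit
    | .reg i => .inl i
    | .wt z => .inr (.inl z)
    | .err x => .inr (.inr (.inl x))
    | .sum x => .inr (.inr (.inr (.inl x)))
    | .res => .inr (.inr (.inr (.inr ())))
  have hf : f.Injective := by
    rintro (_ | _ | _ | _ | _) (_ | _ | _ | _ | _) h <;> simp_all [f]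
  obtain ⟨g, hg⟩ := exists_injective_nat (ℕ ⊕ V ⊕ W ⊕ W ⊕ Unit)
  exact ⟨g ∘ f, hg.comp hf⟩

/-! ### Simulation of single operations -/

namespace DataStructure

variable {V W : Type u}

/-- The instructions executed during a sequence of operations. -/
def progAll (D : DataStructure V) : D.State → List (OpShape V) → List (Instr V)
  | _, [] => []
  | s, o :: l => D.prog s o ++ D.progAll (D.next s o) l

theorem costAll_progAll (D : DataStructure V) (s : D.State) (l : List (OpShape V)) :
    Instr.costAll (D.progAll s l) = D.costFrom s l := by
  induction l generalizing s with
  | nil => rfl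
  | cons o l ih => rw [progAll, Instr.costAll_append, ih, costFrom]

/-- A program on `V`, executed on the registers of a simulation. -/
def simProg (e : Slot V W → ℕ) (p : List (Instr V)) : List (Instr W) :=
  p.map (Instr.map (fun i => e (.reg i)) fun z => .reg (e (.wt z)))

section SimProg

variable {e : Slot V W → ℕ} {G : Type u} [AddCommGroup G]

theorem execAll_simProg_slot (he : e.Injective) (p : List (Instr V)) (w : W → G) (R : ℕ → G)
    {t : Slot V W} (ht : ∀ i, t ≠ .reg i) : Instr.execAll w R (simProg e p) (e t) = R (e t) :=
  Instr.execAll_map_of_notMem_range p R fun i => he.ne (ht i).symm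

theorem execAll_simProg_reg (he : e.Injective) (p : List (Instr V)) (w : W → G) (R : ℕ → G) :
    (fun i => Instr.execAll w R (simProg e p) (e (.reg i))) =
      Instr.execAll (fun z => R (e (.wt z))) (fun i => R (e (.reg i))) p := by
  refine Instr.execAll_map (f := fun i => e (.reg i)) (fun i j h => ?_) (fun v i h => ?_) p R
    fun _ => rfl
  · simpa using he h
  · simpa using he (Cell.reg.inj h)

theorem Reach.simProg {D : DataStructure V} {F Fd : RootedForest V} {s : D.State} {w : V → G}
    {R : ℕ → G} (h : D.Reach F Fd s w R) (he : e.Injective) (op : Op V G) (hop : Fd.LegalOp op)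
    (w' : W → G) {R' : ℕ → G} (hw : (fun z => R' (e (.wt z))) = op.newWeights w)
    (hR : (fun i => R' (e (.reg i))) = R) :
    D.Reach F (Fd.apply op) (D.next s op.shape)
      (fun z => Instr.execAll w' R' (simProg e (D.prog s op.shape)) (e (.wt z)))
      (fun i => Instr.execAll w' R' (simProg e (D.prog s op.shape)) (e (.reg i))) := by
  rw [execAll_simProg_reg he]
  have : (fun z => Instr.execAll w' R' (DataStructure.simProg e (D.prog s op.shape)) (e (.wt z))) =
      fun z => R' (e (.wt z)) := by
    funext z
    exact execAll_simProg_slot he _ _ _ fun i => by simp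
  rw [this, hw, hR]
  exact h.step op hop

end SimProg

variable [Fintype W]

/-- The invariant of the simulation: `D` runs on the weights `wt`, which differ from the actual
weights by `err`, and the sums of `err` below all relevant vertices are available in `sum`. -/
structure SimInv (D : DataStructure V) (F : RootedForest V) (ι : W → V) (e : Slot V W → ℕ)
    (H : RootedForest W) (Fd : RootedForest V) (A : Set W) (s : D.State)
    {G : Type u} [AddCommGroup G] (w : W → G) (R : ℕ → G) : Prop where
  reach : D.Reach F Fd s (fun z => R (e (.wt z))) (fun i => R (e (.reg i)))
  wt : ∀ x, R (e (.wt (ι x))) = w x - R (e (.err x))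
  supp : ∀ z, R (e (.wt z)) ≠ 0 → ∃ x ∈ A, ι x = z
  sum : ∀ y, (y ∉ H.aux ∨ H.parent y = none) →
    H.descSum (fun x => R (e (.err x))) y = R (e (.sum y))

namespace SimInv

variable {D : DataStructure V} {F Fd : RootedForest V} {ι : W → V} {e : Slot V W → ℕ}
  {H : RootedForest W} {A A' : Set W} {s : D.State} {G : Type u} [AddCommGroup G] {w : W → G}
  {R : ℕ → G} {v r a : W}

/-- For cuts and tree sums performed by `D` alone: its weights do not change, so the errors and
their sums persist. -/
theorem run_of_newWeights_eq (h : SimInv D F ι e H Fd A s w R) (he : e.Injective) (op : Op V G)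
    (hop : Fd.LegalOp op)
    (hw : op.newWeights (fun z => R (e (.wt z))) = fun z => R (e (.wt z))) (w' : W → G) :
    SimInv D F ι e H (Fd.apply op) A (D.next s op.shape) w
      (Instr.execAll w' R (simProg e (D.prog s op.shape))) := by
  have hs : ∀ t : Slot V W, (∀ i, t ≠ .reg i) →
      Instr.execAll w' R (simProg e (D.prog s op.shape)) (e t) = R (e t) :=
    fun t ht => execAll_simProg_slot he _ _ _ ht
  refine ⟨h.reach.simProg he op hop w' hw.symm rfl, fun x => ?_, fun z hz => ?_, fun y hy => ?_⟩
  · rw [hs _ (by simp), hs _ (by simp), h.wt]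
  · rw [hs _ (by simp)] at hz
    exact h.supp z hz
  · rw [hs _ (by simp), ← h.sum y hy]
    congr 1
    funext x
    exact hs _ (by simp)

theorem run_cuts (h : SimInv D F ι e H Fd A s w R) (he : e.Injective) {l : List (OpShape V)}
    (hl : ∀ o ∈ l, ∃ z, o = .cut z) (hleg : Fd.Legal l) (w' : W → G) :
    SimInv D F ι e H (Fd.applyAll l) A (D.nextAll s l) w
      (Instr.execAll w' R (simProg e (D.progAll s l))) := by
  induction l generalizing Fd s R with
  | nil => exact h
  | cons o l ih =>
    obtain ⟨z, rfl⟩ := hl _ List.mem_cons_self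
    have := ih (h.run_of_newWeights_eq he (.cut z) hleg.1 rfl w')
      (fun o ho => hl o (List.mem_cons_of_mem _ ho)) hleg.2
    rw [← Instr.execAll_append] at this
    rw [progAll, DataStructure.simProg, List.map_append]
    exact this

theorem mono (h : SimInv D F ι e H Fd A s w R) (hA : A ⊆ A') : SimInv D F ι e H Fd A' s w R where
  reach := h.reach
  wt := h.wt
  supp z hz := by
    obtain ⟨x, hx, hz⟩ := h.supp z hz
    exact ⟨x, hA hx, hz⟩
  sum := h.sum

/-- The tree of `ι v` may be larger than the image of the tree of `v`. However, `D` has nonzero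
weights only at images of active vertices, and by `sep` those in this tree come from the tree of
`v`. So the answer of `D` misses exactly the error below the root. -/
theorem treeSum_add (h : SimInv D F ι e H Fd A s w R) [Fintype V] (hι : ι.Injective)
    (hc : H.Coupled ι Fd A) (hv : v ∈ A) (hr : H.Anc v r) (hr' : H.parent r = none) :
    Fd.treeSum (fun z => R (e (.wt z))) (ι v) + R (e (.sum r)) = H.treeSum w v := by
  classical
  have h1 : Fd.treeSum (fun z => R (e (.wt z))) (ι v) = H.descSum (fun x => R (e (.wt (ι x)))) r := by
    rw [RootedForest.treeSum, RootedForest.descSum]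
    refine (Eq.trans (Finset.sum_map (Finset.univ.filter fun x => H.Anc x r) ⟨ι, hι⟩
      (fun z => R (e (.wt z)))).symm ?_).symm
    refine Finset.sum_subset (fun z hz => ?_) fun z hz hz' => ?_
    · obtain ⟨x, hx, rfl⟩ := Finset.mem_map.1 hz
      simp only [Finset.mem_filter, Finset.mem_univ, true_and] at hx ⊢
      exact RootedForest.reachable_iff.2 ⟨_, hc.anc hr, hc.anc hx⟩
    · by_contra hne
      obtain ⟨x, hx, rfl⟩ := h.supp z hne
      refine hz' (Finset.mem_map.2 ⟨x, ?_, rfl⟩)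
      simp only [Finset.mem_filter, Finset.mem_univ, true_and] at hz ⊢
      exact (RootedForest.reachable_iff_anc_root hr hr').1 (hc.sep v x hv hx hz)
  rw [h1, ← h.sum r (Or.inr hr'), RootedForest.treeSum_eq_descSum w hr hr', RootedForest.descSum,
    RootedForest.descSum, RootedForest.descSum, ← Finset.sum_add_distrib]
  refine Finset.sum_congr rfl fun x _ => ?_
  rw [h.wt, sub_add_cancel]

end SimInv

end DataStructure

namespace DataStructure

variable {V W : Type u} [Fintype W] {D : DataStructure V} {F : RootedForest V} {ι : W → V}
  {e : Slot V W → ℕ} {H : RootedForest W} {Fd : RootedForest V} {A : Set W} {s : D.State} {v : W}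

variable (D F ι e H Fd A s) in
/-- The simulation can perform `op`, with two additions or subtractions and the operations `tr` of
`D`. -/
def SimStep (op : OpShape W) (tr : List (OpShape V)) (A' : Set W) (p : List (Instr W)) : Prop :=
  (H.apply op).Coupled ι (Fd.applyAll tr) A' ∧ Fd.Legal tr ∧
  (∀ o ∈ tr, ∀ z, o = .cut z → z ∈ Set.range ι) ∧ Instr.costAll p ≤ 2 + D.costFrom s tr ∧
  ∀ (G : Type u) [AddCommGroup G] (w : W → G) (R : ℕ → G) (o : Op W G), o.shape = op →
    SimInv D F ι e H Fd A s w R →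
    SimInv D F ι e (H.apply op) (Fd.applyAll tr) A' (D.nextAll s tr) (o.newWeights w)
      (Instr.execAll (o.newWeights w) R p) ∧
    ∀ v, op = .treeSum v → Instr.execAll (o.newWeights w) R p (e .res) = H.treeSum w v

theorem simStep_treeSum [Fintype V] (hD : D.IsTreeSumFor F) (hι : ι.Injective) (he : e.Injective)
    (hc : H.Coupled ι Fd A) (hv : v ∈ A) (hva : v ∉ H.aux) :
    ∃ p, SimStep D F ι e H Fd A s (.treeSum v) [.treeSum (ι v)] A p := by
  obtain ⟨r, hr, hr'⟩ := H.exists_root v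
  have hleg : ι v ∉ Fd.aux := by rwa [hc.aux]
  refine ⟨simProg e (D.prog s (.treeSum (ι v))) ++ [.add (e .res)
    ((D.ret s (ι v)).map (fun i => e (.reg i)) fun z => .reg (e (.wt z))) (.reg (e (.sum r)))],
    hc, ⟨hleg, True.intro⟩, by simp, ?_, ?_⟩
  · rw [Instr.costAll_append, simProg, Instr.costAll_map]
    simp [Instr.costAll, Instr.cost, costFrom]
  · intro G _ w R o ho h
    obtain rfl : o = .treeSum v := by
      cases o <;> simp_all [Op.shape]
    have h1 := h.run_of_newWeights_eq he (.treeSum (ι v)) hleg rfl w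
    have hs : ∀ t : Slot V W, (∀ i, t ≠ .reg i) →
        Instr.execAll w R (simProg e (D.prog s (.treeSum (ι v)))) (e t) = R (e t) :=
      fun t ht => execAll_simProg_slot he _ _ _ ht
    simp only [Op.newWeights, Op.shape] at h1 ⊢
    rw [Instr.execAll_append]
    set R1 := Instr.execAll w R (simProg e (D.prog s (.treeSum (ι v))))
    have hret : Cell.read w R1 ((D.ret s (ι v)).map (fun i => e (.reg i)) fun z => .reg (e (.wt z)))
        = Fd.treeSum (fun z => R (e (.wt z))) (ι v) := by
      rw [← h.reach.ret_read hD hleg, Cell.read_map (w := fun z => R (e (.wt z)))]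
      · exact congrArg (fun R' => Cell.read _ R' _) (execAll_simProg_reg he _ _ _)
      · exact fun z => hs _ (by simp)
    set g := Cell.read w R1
      ((D.ret s (ι v)).map (fun i => e (.reg i)) fun z => .reg (e (.wt z))) + R1 (e (.sum r))
    have hR2 : Instr.execAll w R1 [.add (e .res)
        ((D.ret s (ι v)).map (fun i => e (.reg i)) fun z => .reg (e (.wt z)))
        (.reg (e (.sum r)))] = Function.update R1 (e .res) g := rfl
    rw [hR2]
    have hne : ∀ t : Slot V W, t ≠ .res → Function.update R1 (e .res) g (e t) = R1 (e t) :=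
      fun t ht => Function.update_of_ne (he.ne ht) _ _
    refine ⟨⟨?_, fun x => ?_, fun z hz => ?_, fun y hy => ?_⟩, ?_⟩
    · simp only [hne _ (show Slot.wt _ ≠ Slot.res by simp),
        hne _ (show Slot.reg _ ≠ Slot.res by simp)]
      exact h1.reach
    · rw [hne _ (by simp), hne _ (by simp)]
      exact h1.wt x
    · rw [hne _ (by simp)] at hz
      exact h1.supp z hz
    · simp only [hne _ (show Slot.err _ ≠ Slot.res by simp),
        hne _ (show Slot.sum _ ≠ Slot.res by simp)]
      exact h1.sum y hy
    · intro v' hv'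
      obtain rfl : v = v' := by simpa using hv'
      rw [Function.update_self, ← h.treeSum_add hι hc hv hr hr', ← hret, ← hs (.sum r) (by simp)]

theorem simStep_updateWeight (hι : ι.Injective) (he : e.Injective)
    (hc : H.Coupled ι Fd A) (hv : v ∈ A) (hva : v ∉ H.aux) :
    ∃ p, SimStep D F ι e H Fd A s (.updateWeight v PUnit.unit) [.updateWeight (ι v) PUnit.unit] A p := by
  classical
  have hleg : ι v ∉ Fd.aux := by rwa [hc.aux]
  -- `D` receives the new weight minus the error of `v`, so that no error and no stored sum has to
  -- change.
  refine ⟨[.sub (e (.wt (ι v))) (.weight v) (.reg (e (.err v)))] ++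
    simProg e (D.prog s (.updateWeight (ι v) PUnit.unit)), hc, ⟨hleg, True.intro⟩, by simp, ?_, ?_⟩
  · rw [Instr.costAll_append, simProg, Instr.costAll_map]
    simp [Instr.costAll, Instr.cost, costFrom]
  · intro G _ w R o ho h
    obtain ⟨x, rfl⟩ : ∃ x, o = .updateWeight v x := by
      cases o <;> simp_all [Op.shape]
    refine ⟨?_, by simp⟩
    rw [Instr.execAll_append]
    set w' := (Op.updateWeight v x).newWeights w
    have hw' : w' v = x := by simp [w', Op.newWeights]
    have hw'' : ∀ y, y ≠ v → w' y = w y := fun y hy => by simp [w', Op.newWeights, hy]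
    set R1 := Instr.execAll w' R [.sub (e (.wt (ι v))) (.weight v) (.reg (e (.err v)))]
    have hR1 : R1 = Function.update R (e (.wt (ι v))) (x - R (e (.err v))) := by
      rw [← hw']
      rfl
    have hne : ∀ t : Slot V W, t ≠ .wt (ι v) → R1 (e t) = R (e t) := fun t ht => by
      rw [hR1, Function.update_of_ne (he.ne ht)]
    have hself : R1 (e (.wt (ι v))) = x - R (e (.err v)) := by
      rw [hR1, Function.update_self]
    have hs : ∀ t : Slot V W, (∀ i, t ≠ .reg i) →
        Instr.execAll w' R1 (simProg e (D.prog s (.updateWeight (ι v) PUnit.unit))) (e t) =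
          R1 (e t) :=
      fun t ht => execAll_simProg_slot he _ _ _ ht
    have herr : ∀ y, Instr.execAll w' R1 (simProg e (D.prog s (.updateWeight (ι v) PUnit.unit)))
        (e (.err y)) = R (e (.err y)) := fun y => by
      rw [hs _ (by simp), hne _ (by simp)]
    refine ⟨?_, fun y => ?_, fun z hz => ?_, fun y hy => ?_⟩
    · refine h.reach.simProg he (.updateWeight (ι v) (x - R (e (.err v)))) hleg w' ?_ ?_
      · funext z
        by_cases hz : z = ι v
        · subst hz
          simp [hself, Op.newWeights]
        · rw [hne _ (by simpa using hz)]
          simp [Op.newWeights, hz]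
      · funext i
        exact hne _ (by simp)
    · rw [herr, hs _ (by simp)]
      by_cases hy : y = v
      · subst hy
        rw [hself, hw']
      · rw [hne _ (by simpa using hι.ne hy), hw'' y hy]
        exact h.wt y
    · rw [hs _ (by simp)] at hz
      by_cases hzv : z = ι v
      · exact ⟨v, hv, hzv.symm⟩
      · rw [hne _ (by simpa using hzv)] at hz
        exact h.supp z hz
    · simp only [herr]
      rw [hs _ (by simp), hne _ (by simp)]
      exact h.sum y hy

/-- Without a non-auxiliary proper ancestor there is no place for the error below `v`. But then the
root is the only proper ancestor whose sum is tracked, and one subtraction corrects it. -/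
theorem SimInv.cut_of_forall_aux {G : Type u} [AddCommGroup G] {w : W → G} {R : ℕ → G} {r : W}
    (h : SimInv D F ι e H Fd A s w R) (he : e.Injective) (hv : v ∉ H.aux) (hr : H.Anc v r)
    (hr' : H.parent r = none) (hne : v ≠ r) (ha : ∀ y, y ∉ H.aux → H.Anc v y → v = y) :
    SimInv D F ι e (H.cut v) Fd A s w
      (Function.update R (e (.sum r)) (R (e (.sum r)) - R (e (.sum v)))) := by
  classical
  set g := R (e (.sum r)) - R (e (.sum v))
  have hs : ∀ t : Slot V W, t ≠ .sum r → Function.update R (e (.sum r)) g (e t) = R (e t) :=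
    fun t ht => Function.update_of_ne (he.ne ht) _ _
  refine ⟨?_, fun x => ?_, fun z hz => ?_, fun y hy => ?_⟩
  · simp only [hs _ (show Slot.wt _ ≠ Slot.sum r by simp),
      hs _ (show Slot.reg _ ≠ Slot.sum r by simp)]
    exact h.reach
  · rw [hs _ (by simp), hs _ (by simp)]
    exact h.wt x
  · rw [hs _ (by simp)] at hz
    exact h.supp z hz
  · simp only [hs _ (show Slot.err _ ≠ Slot.sum r by simp)]
    rw [RootedForest.cut_descSum_of_forall_aux (S := fun y => R (e (.sum y))) hv h.sum hr hr' hne ha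
      hy]
    by_cases hyr : y = r
    · subst hyr
      rw [Function.update_self, Function.update_self]
    · rw [Function.update_of_ne hyr, hs _ (by simpa using hyr)]

theorem simStep_cut (hι : ι.Injective) (he : e.Injective)
    (hc : H.Coupled ι Fd A) (hv : v ∈ A) (hva : v ∉ H.aux) (hp : H.parent v ≠ none) :
    ∃ tr p, tr.length ≤ 2 ∧ SimStep D F ι e H Fd A s (.cut v) tr A p := by
  classical
  have hleg : ι v ∉ Fd.aux := by rwa [hc.aux]
  have hleg' : Fd.parent (ι v) ≠ none := by
    obtain ⟨q, hq⟩ := Option.ne_none_iff_exists'.1 hp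
    rw [hc.parent v q hq]
    simp
  have hc' := hc.cut hι hva
  by_cases hex : ∃ y, y ∉ H.aux ∧ H.Anc v y ∧ v ≠ y
  · obtain ⟨a, ⟨haa, hva', hne⟩, ha⟩ := RootedForest.exists_nearest_nonaux hex
    have haA : a ∈ A := hc.closed v a hv hva'.reachable
    have hlega : ι a ∉ Fd.aux := by rwa [hc.aux]
    -- The error sum below `v` is added to the error of `a`, and the weight of `a` in `D` is reset
    -- to match. The stored sums are left alone.
    refine ⟨[.cut (ι v), .updateWeight (ι a) PUnit.unit],
      simProg e (D.prog s (.cut (ι v))) ++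
        ([.add (e (.err a)) (.reg (e (.err a))) (.reg (e (.sum v))),
          .sub (e (.wt (ι a))) (.weight a) (.reg (e (.err a)))] ++
        simProg e (D.prog (D.next s (.cut (ι v))) (.updateWeight (ι a) PUnit.unit))),
      le_rfl, hc', ⟨⟨hleg, hleg'⟩, hlega, True.intro⟩, by simp, ?_, ?_⟩
    · rw [Instr.costAll_append, Instr.costAll_append, simProg, simProg, Instr.costAll_map,
        Instr.costAll_map]
      simp [Instr.costAll, Instr.cost, costFrom]
      omega
    · intro G _ w R o ho h
      obtain rfl : o = .cut v := by
        cases o <;> simp_all [Op.shape]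
      refine ⟨?_, by simp⟩
      have h1 := h.run_of_newWeights_eq he (.cut (ι v)) ⟨hleg, hleg'⟩ rfl w
      simp only [Op.newWeights, Op.shape] at h1 ⊢
      rw [Instr.execAll_append, Instr.execAll_append]
      set R1 := Instr.execAll w R (simProg e (D.prog s (.cut (ι v))))
      set R2 := Instr.execAll w R1 [.add (e (.err a)) (.reg (e (.err a))) (.reg (e (.sum v))),
          .sub (e (.wt (ι a))) (.weight a) (.reg (e (.err a)))]
      set E : W → G := fun x => R1 (e (.err x))
      have hR2 : R2 = Function.update (Function.update R1 (e (.err a)) (E a + R1 (e (.sum v))))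
          (e (.wt (ι a))) (w a - (E a + R1 (e (.sum v)))) := by
        have : Function.update R1 (e (.err a)) (E a + R1 (e (.sum v))) (e (.err a)) =
          E a + R1 (e (.sum v)) := Function.update_self _ _ _
        rw [← this]
        simp only [R2, Instr.execAll_cons, Instr.execAll_nil, Instr.exec, Cell.read, E,
          Function.update_self]
      have hne2 : ∀ t : Slot V W, t ≠ .wt (ι a) → t ≠ .err a → R2 (e t) = R1 (e t) :=
        fun t ht ht' => by
          rw [hR2, Function.update_of_ne (he.ne ht), Function.update_of_ne (he.ne ht')]
      have hwt : R2 (e (.wt (ι a))) = w a - (E a + R1 (e (.sum v))) := by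
        rw [hR2, Function.update_self]
      have herr : R2 (e (.err a)) = E a + R1 (e (.sum v)) := by
        rw [hR2, Function.update_of_ne (he.ne (by simp)), Function.update_self]
      have hs : ∀ t : Slot V W, (∀ i, t ≠ .reg i) → Instr.execAll w R2 (simProg e
          (D.prog (D.next s (.cut (ι v))) (.updateWeight (ι a) PUnit.unit))) (e t) = R2 (e t) :=
        fun t ht => execAll_simProg_slot he _ _ _ ht
      refine ⟨?_, fun y => ?_, fun z hz => ?_, fun y hy => ?_⟩
      · refine h1.reach.simProg he (.updateWeight (ι a) (w a - (E a + R1 (e (.sum v))))) hlega w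
          ?_ ?_
        · funext z
          by_cases hz : z = ι a
          · subst hz
            simp [hwt, Op.newWeights]
          · rw [hne2 _ (by simpa using hz) (by simp)]
            simp [Op.newWeights, hz]
        · funext i
          exact hne2 _ (by simp) (by simp)
      · rw [hs _ (by simp), hs _ (by simp)]
        by_cases hy : y = a
        · subst hy
          rw [hwt, herr]
        · rw [hne2 _ (by simpa using hι.ne hy) (by simp), hne2 _ (by simp) (by simpa using hy)]
          exact h1.wt y
      · rw [hs _ (by simp)] at hz
        by_cases hza : z = ι a
        · exact ⟨a, haA, hza.symm⟩
        · rw [hne2 _ (by simpa using hza) (by simp)] at hz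
          exact h1.supp z hz
      · rw [hs _ (by simp), hne2 _ (by simp) (by simp)]
        have hE : (fun x => Instr.execAll w R2 (simProg e
            (D.prog (D.next s (.cut (ι v))) (.updateWeight (ι a) PUnit.unit))) (e (.err x))) =
            Function.update E a (E a + R1 (e (.sum v))) := by
          funext x
          rw [hs _ (by simp)]
          by_cases hx : x = a
          · subst hx
            rw [herr, Function.update_self]
          · rw [hne2 _ (by simp) (by simpa using hx), Function.update_of_ne hx]
        rw [hE]
        exact RootedForest.cut_descSum_update (S := fun y => R1 (e (.sum y))) hva h1.sum hva' hne ha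
          hy
  · push Not at hex
    obtain ⟨r, hr, hr'⟩ := H.exists_root v
    have hne : v ≠ r := by
      rintro rfl
      exact hp hr'
    refine ⟨[.cut (ι v)], simProg e (D.prog s (.cut (ι v))) ++
      [.sub (e (.sum r)) (.reg (e (.sum r))) (.reg (e (.sum v)))], by simp, hc',
      ⟨⟨hleg, hleg'⟩, True.intro⟩, by simp, ?_, ?_⟩
    · rw [Instr.costAll_append, simProg, Instr.costAll_map]
      simp [Instr.costAll, Instr.cost, costFrom]
    · intro G _ w R o ho h
      obtain rfl : o = .cut v := by
        cases o <;> simp_all [Op.shape]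
      refine ⟨?_, by simp⟩
      have h1 := h.run_of_newWeights_eq he (.cut (ι v)) ⟨hleg, hleg'⟩ rfl w
      rw [Instr.execAll_append]
      exact h1.cut_of_forall_aux he hva hr hr' hne hex

/-- Every legal operation can be simulated with at most three operations of `D`. -/
theorem exists_simStep [Fintype V] (hD : D.IsTreeSumFor F) (hι : ι.Injective) (he : e.Injective)
    (hc : H.Coupled ι Fd A) (op : OpShape W) (hop : H.LegalOp op) :
    ∃ tr A' p, tr.length ≤ 3 ∧ SimStep D F ι e H Fd A s op tr A' p := by
  obtain ⟨v, hv⟩ : ∃ v, op = .cut v ∨ op = .treeSum v ∨ op = .updateWeight v PUnit.unit := by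
    cases op <;> simp
  obtain ⟨l, A', hl, hcut, hleg, hA, hvA, hc'⟩ := hc.exists_activate hι v
  have hmain : ∃ tr p, tr.length ≤ 2 ∧
      SimStep D F ι e H (Fd.applyAll l) A' (D.nextAll s l) op tr A' p := by
    rcases hv with rfl | rfl | rfl
    · exact simStep_cut hι he hc' hvA hop.1 hop.2
    · obtain ⟨p, hp⟩ := simStep_treeSum (s := D.nextAll s l) hD hι he hc' hvA hop
      exact ⟨_, p, by simp, hp⟩
    · obtain ⟨p, hp⟩ := simStep_updateWeight (D := D) (F := F) (s := D.nextAll s l) hι he hc' hvA hop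
      exact ⟨_, p, by simp, hp⟩
  obtain ⟨tr, p, htr, h1, h2, h3, h4, h5⟩ := hmain
  refine ⟨l ++ tr, A', simProg e (D.progAll s l) ++ p, ?_, ?_, ?_, ?_, ?_, ?_⟩
  · rw [List.length_append]
    omega
  · rwa [RootedForest.applyAll_append]
  · exact RootedForest.legal_append.2 ⟨hleg, h2⟩
  · intro o ho z hz
    rcases List.mem_append.1 ho with ho | ho
    · obtain ⟨x, rfl⟩ := hcut o ho
      rw [Op.cut.injEq] at hz
      exact ⟨x, hz⟩
    · exact h3 o ho z hz
  · rw [Instr.costAll_append, simProg, Instr.costAll_map, costAll_progAll, costFrom_append]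
    omega
  · intro G _ w R o ho h
    have hcut' : ∀ o ∈ l, ∃ z, o = .cut z := fun o ho => by
      obtain ⟨x, hx⟩ := hcut o ho
      exact ⟨_, hx⟩
    have h6 := (h.run_cuts he hcut' hleg (o.newWeights w)).mono hA
    rw [Instr.execAll_append, RootedForest.applyAll_append, nextAll_append]
    exact h5 G w _ o ho h6

end DataStructure

/-! ### The simulating data structure -/

namespace DataStructure

variable {V W : Type u} [Fintype V] [Fintype W]

/-- A data structure for `F`, started in a reachable control state with all weights zero, can be
used to build a data structure for a forest `H` that is coupled to the current forest. -/
theorem exists_simulation {D : DataStructure V} {F Fd : RootedForest V} (hD : D.IsTreeSumFor F)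
    {s : D.State} (hs : D.Reach F Fd s (fun _ => PUnit.unit) (fun _ => PUnit.unit))
    {ι : W → V} (hι : ι.Injective) {H : RootedForest W} {A : Set W} (hc : H.Coupled ι Fd A) :
    ∃ D' : DataStructure W, D'.IsTreeSumFor H ∧ ∀ ops, H.Legal ops →
      ∃ tr, Fd.Legal tr ∧ tr.length ≤ 3 * ops.length ∧
        (∀ z ∉ Set.range ι, (Fd.applyAll tr).parent z = Fd.parent z) ∧
        D'.cost ops ≤ Fintype.card W + 2 * ops.length + D.costFrom s tr := by
  classical
  obtain ⟨e, he⟩ := Slot.exists_injective V W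
  have hstep : ∀ (st : RootedForest W × RootedForest V × Set W × D.State) (op : OpShape W),
      st.1.Coupled ι st.2.1 st.2.2.1 → st.1.LegalOp op → ∃ tr A' p, tr.length ≤ 3 ∧
        SimStep D F ι e st.1 st.2.1 st.2.2.1 st.2.2.2 op tr A' p :=
    fun st op hc hop => exists_simStep hD hι he hc op hop
  -- The coupling holds in every control state reached by legal operations; the values chosen for
  -- other states are irrelevant.
  choose! tr A' p htr hsim using hstep
  obtain ⟨q, hq, hq'⟩ := H.exists_descSum_prog (σ := fun y => e (.sum y))
    (fun x y h => by simpa using he h)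
  let D' : DataStructure W :=
    { State := RootedForest W × RootedForest V × Set W × D.State
      init := (H, Fd, A, s)
      -- All weights in `D` are zero at the start, so the error is the entire weight. Only the error
      -- sums cost additions, the copies are free.
      initProg := q ++ Finset.univ.toList.map fun x => .copy (e (.err x)) (.weight x)
      next := fun st op => (st.1.apply op, st.2.1.applyAll (tr st op), A' st op,
        D.nextAll st.2.2.2 (tr st op))
      prog := p
      ret := fun _ _ => .reg (e .res) }
  refine ⟨D', isTreeSumFor_of_invariant fun G _ => ⟨fun Fc st w R => st.1 = Fc ∧
    st.1.Coupled ι st.2.1 st.2.2.1 ∧ SimInv D F ι e st.1 st.2.1 st.2.2.1 st.2.2.2 w R,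
    ?_, ?_, ?_⟩, ?_⟩
  · intro w _
    refine ⟨rfl, hc, ?_⟩
    obtain ⟨h1, h2⟩ := hq' G w (fun _ => 0)
    have herr : Function.Injective fun x : W => e (.err x) := fun x y h => by simpa using he h
    obtain ⟨h3, h4⟩ := Instr.execAll_copy_weight herr Finset.univ.toList w
      (Instr.execAll w (fun _ => 0) q)
    have key : ∀ t : Slot V W, (∀ x, t ≠ .err x) → (∀ x, t ≠ .sum x) →
        Instr.execAll w (fun _ => 0) D'.initProg (e t) = 0 := by
      intro t ht ht'
      rw [Instr.execAll_append, h4 _ fun x => he.ne (ht x).symm, h2 _ fun x => he.ne (ht' x).symm]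
    have hE : ∀ x, Instr.execAll w (fun _ => 0) D'.initProg (e (.err x)) = w x := fun x => by
      rw [Instr.execAll_append]
      exact h3 x (by simp)
    refine ⟨?_, fun x => ?_, fun z hz => absurd (key _ (by simp) (by simp)) hz, fun y _ => ?_⟩
    · have := hs.zero G
      convert this using 2
      · exact key _ (by simp) (by simp)
      · exact key _ (by simp) (by simp)
    · rw [key _ (by simp) (by simp), hE, sub_self]
    · simp only [hE]
      rw [Instr.execAll_append, h4 _ fun x => he.ne (by simp)]
      exact (h1 y).symm
  · rintro Fc st w R op ⟨rfl, h1, h2⟩ hop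
    have hop' : st.1.LegalOp op.shape := RootedForest.legalOp_shape.2 hop
    obtain ⟨h3, -, -, -, h4⟩ := hsim st op.shape h1 hop'
    exact ⟨RootedForest.apply_shape _ _, h3, (h4 G w R op rfl h2).1⟩
  · rintro Fc st w R v ⟨rfl, h1, h2⟩ hv
    obtain ⟨-, -, -, -, h4⟩ := hsim st (.treeSum v) h1 hv
    exact (h4 G w R (.treeSum v) rfl h2).2 v rfl
  · have main : ∀ (ops : List (OpShape W))
        (st : RootedForest W × RootedForest V × Set W × D.State), st.1.Legal ops →
        st.1.Coupled ι st.2.1 st.2.2.1 → ∃ l, st.2.1.Legal l ∧ l.length ≤ 3 * ops.length ∧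
          (∀ z ∉ Set.range ι, (st.2.1.applyAll l).parent z = st.2.1.parent z) ∧
          D'.costFrom st ops ≤ 2 * ops.length + D.costFrom st.2.2.2 l := by
      intro ops
      induction ops with
      | nil => exact fun st _ _ => ⟨[], True.intro, le_rfl, fun _ _ => rfl, Nat.zero_le _⟩
      | cons op ops ih =>
        intro st hops hc
        obtain ⟨h1, h2, h3, h4, -⟩ := hsim st op hc hops.1
        obtain ⟨l, h5, h6, h7, h8⟩ := ih (D'.next st op) hops.2 h1
        refine ⟨tr st op ++ l, RootedForest.legal_append.2 ⟨h2, h5⟩, ?_, fun z hz => ?_, ?_⟩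
        · have := htr st op hc hops.1
          rw [List.length_append, List.length_cons]
          omega
        · rw [RootedForest.applyAll_append]
          exact (h7 z hz).trans (RootedForest.applyAll_parent_of_forall h3 hz)
        · rw [costFrom_append, List.length_cons]
          have h9 : D'.costFrom st (op :: ops) =
            Instr.costAll (p st op) + D'.costFrom (D'.next st op) ops := rfl
          have h10 : D.costFrom (D'.next st op).2.2.2 l =
            D.costFrom (D.nextAll st.2.2.2 (tr st op)) l := rfl
          omega
    intro ops hops
    obtain ⟨l, h1, h2, h3, h4⟩ := main ops (H, Fd, A, s) hops hc
    refine ⟨l, h1, h2, h3, ?_⟩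
    have h5 : Instr.costAll D'.initProg ≤ Fintype.card W := by
      refine (Instr.costAll_append _ _).trans_le ?_
      rw [Instr.costAll_copy_weight (W := W) (fun x => e (.err x))]
      exact hq
    have h6 : D'.costFrom D'.init ops = D'.costFrom (H, Fd, A, s) ops := rfl
    rw [cost]
    simp only at h4
    omega

end DataStructure

/-! ### The two couplings: later forests and parts of a partition -/

namespace RootedForest

variable {V : Type u}

theorem applyAll_parent_of_some (F : RootedForest V) (ops : List (OpShape V)) {x p : V}
    (h : (F.applyAll ops).parent x = some p) : F.parent x = some p := by
  induction ops generalizing F with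
  | nil => exact h
  | cons o ops ih =>
    have h1 := ih _ h
    cases o with
    | treeSum v => exact h1
    | updateWeight v x => exact h1
    | cut v =>
      by_cases hx : x = v
      · subst hx
        exact absurd (h1.symm.trans cut_parent_self) (by simp)
      · exact (cut_parent_of_ne hx).symm.trans h1

theorem notMem_aux_of_applyAll_parent {F : RootedForest V} {ops : List (OpShape V)}
    (hops : F.Legal ops) {x : V} (h : (F.applyAll ops).parent x = none)
    (h' : F.parent x ≠ none) : x ∉ F.aux := by
  induction ops generalizing F with
  | nil => exact absurd h h'
  | cons o ops ih =>
    rw [← apply_aux F o]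
    by_cases hx : (F.apply o).parent x = none
    · rw [apply_aux]
      cases o with
      | treeSum v => exact absurd hx h'
      | updateWeight v x => exact absurd hx h'
      | cut v =>
        by_cases hxv : x = v
        · exact hxv ▸ hops.1.1
        · exact absurd ((cut_parent_of_ne hxv).symm.trans hx) h'
    · exact ih hops.2 h hx

/-- The engine starts from the uncut forest `F`. Declaring all vertices inactive makes separation
vacuous, so the missing cuts can be postponed until vertices are used. -/
theorem coupled_applyAll {F : RootedForest V} {ops : List (OpShape V)} (hops : F.Legal ops) :
    (F.applyAll ops).Coupled id F ∅ where
  parent x p h := F.applyAll_parent_of_some ops h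
  aux x := by
    rw [applyAll_aux]
    rfl
  closed _ _ h := absurd h (Set.notMem_empty _)
  sep _ _ h := absurd h (Set.notMem_empty _)
  notMem_aux := by
    refine Or.inr fun z hz hz' => ?_
    rw [applyAll_aux]
    exact notMem_aux_of_applyAll_parent hops hz hz'

theorem induce_parent {F : RootedForest V} {U : Finset V} {x p : U} :
    (F.induce U).parent x = some p ↔ F.parent x = some (p : V) := by
  rw [induce]
  constructor
  · intro h
    obtain ⟨q, hq, h⟩ := Option.bind_eq_some_iff.1 h
    split at h
    · rw [Option.some.injEq] at h
      rw [hq, ← h]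
    · cases h
  · intro h
    refine Option.bind_eq_some_iff.2 ⟨p, h, ?_⟩
    simp

theorem induce_anc {F : RootedForest V} {U : Finset V} {x y : U} (h : (F.induce U).Anc x y) :
    F.Anc x y := by
  induction h using Relation.ReflTransGen.head_induction_on with
  | refl => exact Anc.refl _
  | head h _ ih => exact ih.head (induce_parent.1 h)

/-- A connected part is a single tree, so there is nothing to separate: all its vertices can be
active at once, and no lazy cuts are needed. -/
theorem coupled_induce {F Fd : RootedForest V} {U : Finset V}
    (hU : (F.induce U).graph.Connected) (haux : Fd.aux = F.aux)
    (hparent : ∀ x ∈ U, Fd.parent x = F.parent x) :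
    (F.induce U).Coupled (Subtype.val : U → V) Fd Set.univ where
  parent x p h := (hparent x x.2).trans (induce_parent.1 h)
  aux x := by
    rw [haux]
    rfl
  closed _ _ _ _ := Set.mem_univ _
  sep x y _ _ _ := hU.preconnected x y
  notMem_aux := Or.inl Set.mem_univ

end RootedForest

/-! ### Bounds on `OPT` and the theorem -/

open DataStructure RootedForest

section Bounds

variable {V : Type u} [Fintype V] {F : RootedForest V}

/-- An optimal structure for `F` and `3 * t` operations, started afresh, is simulated on the forest
reached by `ops`. -/
theorem OPT_applyAll_le {ops : List (OpShape V)} (hops : F.Legal ops) {v : V} (hv : v ∉ F.aux)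
    (t : ℕ) :
    OPT (F.applyAll ops) t ≤ (Fintype.card V + 2 * t : ℕ) + OPT F (3 * t) := by
  obtain ⟨D, hD, hD'⟩ := exists_time_eq_OPT F (3 * t)
  obtain ⟨D', h1, h2⟩ := exists_simulation hD (reach_init D F) Function.injective_id
    (coupled_applyAll hops)
  refine (OPT_le_time h1 t).trans (time_le fun ops' h3 h4 => ?_)
  obtain ⟨tr, h5, h6, -, h7⟩ := h2 ops' h3
  rw [h4] at h6 h7
  rw [← hD']
  refine le_trans ?_ (add_le_add_right (cost_le_time hv h5 h6) _)
  have : D.costFrom D.init tr ≤ D.cost tr := Nat.le_add_left _ _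
  rw [← Nat.cast_add, Nat.cast_le]
  omega

/-- `P + 1` phases of `t` operations, each with a new structure for the forest at its beginning. -/
theorem OPT_mul_le {v : V} (hv : v ∉ F.aux) {t : ℕ} (ht : 0 < t) (P : ℕ)
    {ops : List (OpShape V)} (hops : F.Legal ops) :
    OPT (F.applyAll ops) (t * (P + 1)) ≤
      (P + 1 : ℕ) * ((Fintype.card V + 2 * t : ℕ) + OPT F (3 * t)) := by
  induction P generalizing ops with
  | zero => simpa using OPT_applyAll_le hops hv t
  | succ P ih =>
    rw [mul_add_one, add_comm]
    refine (OPT_add_le ht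
      (c := (P + 1 : ℕ) * ((Fintype.card V + 2 * t : ℕ) + OPT F (3 * t))) fun ops' h => ?_).trans
      ((add_le_add_left (OPT_applyAll_le hops hv t) _).trans (le_of_eq ?_))
    · rw [← applyAll_append]
      exact ih (legal_append.2 ⟨hops, h⟩)
    · push_cast
      ring

theorem OPT_nine_mul_le {v : V} (hv : v ∉ F.aux) (m : ℕ) :
    OPT F (9 * m) ≤ 45 * (Fintype.card V + m + OPT F m) := by
  by_cases hm : m < 3
  · refine (OPT_le_mul_card F _).trans ?_
    have : ((9 * m * Fintype.card V : ℕ) : ℕ∞) ≤ 45 * (Fintype.card V : ℕ∞) := by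
      norm_cast
      gcongr
      omega
    refine this.trans ?_
    gcongr
    rw [add_assoc]
    exact le_self_add
  -- With phases of length `m / 3`, the tripled length is at most `m`. For `m ≥ 3` one has `m / 3 *
  -- 45 ≥ 9 * m`, with equality at `m = 5`.
  · have h1 : OPT F (9 * m) ≤ OPT F (m / 3 * (44 + 1)) := OPT_mono hv (by omega)
    have h2 := OPT_mul_le hv (t := m / 3) (by omega) 44 (F := F) (ops := []) True.intro
    refine h1.trans (h2.trans ?_)
    have h3 : OPT F (3 * (m / 3)) ≤ OPT F m := OPT_mono hv (by omega)
    have h4 : ((Fintype.card V + 2 * (m / 3) : ℕ) : ℕ∞) ≤ Fintype.card V + m := by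
      norm_cast
      omega
    exact mul_le_mul' le_rfl (add_le_add h4 h3)

/-- A single run of `D` passes through the parts in turn. Cuts made for earlier parts do not affect
part `j`, so it can be coupled to the current forest; a worst sequence for the resulting simulation
translates into operations of `D` that account for the optimum of part `j` up to its initialization
and two additions per operation. -/
theorem exists_sum_OPT_induce_le {D : DataStructure V} (hD : D.IsTreeSumFor F) {k : ℕ}
    {U : Fin k → Finset V} {ms : Fin k → ℕ} (hdisj : ∀ i j, i ≠ j → Disjoint (U i) (U j))
    (hconn : ∀ i, (F.induce (U i)).graph.Connected) (I : Finset (Fin k)) :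
    ∃ ops : List (OpShape V), F.Legal ops ∧ ops.length ≤ ∑ i ∈ I, 9 * ms i ∧
      (∀ x, (∀ i ∈ I, x ∉ U i) → (F.applyAll ops).parent x = F.parent x) ∧
      ∑ i ∈ I, OPT (F.induce (U i)) (3 * ms i) ≤
        (∑ i ∈ I, ((U i).card + 6 * ms i) + D.costFrom D.init ops : ℕ) := by
  classical
  induction I using Finset.induction_on with
  | empty => exact ⟨[], True.intro, le_rfl, fun _ _ => rfl, by simp⟩
  | insert j I hj ih =>
    obtain ⟨ops, h1, h2, h3, h4⟩ := ih
    have hc : (F.induce (U j)).Coupled (Subtype.val : U j → V) (F.applyAll ops) Set.univ := by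
      refine coupled_induce (hconn j) (applyAll_aux F ops) fun x hx => h3 x fun i hi hxi => ?_
      refine Finset.disjoint_left.1 (hdisj i j ?_) hxi hx
      rintro rfl
      exact hj hi
    obtain ⟨D', h5, h6⟩ := exists_simulation hD ((reach_init D F).nextAll ops h1)
      Subtype.val_injective hc
    have key : ∃ tr, (F.applyAll ops).Legal tr ∧ tr.length ≤ 9 * ms j ∧
        (∀ z, z ∉ U j → ((F.applyAll ops).applyAll tr).parent z = (F.applyAll ops).parent z) ∧
        OPT (F.induce (U j)) (3 * ms j) ≤
          ((U j).card + 6 * ms j + D.costFrom (D.nextAll D.init ops) tr : ℕ) := by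
      -- A part with only auxiliary vertices admits no operations that could be charged, but its
      -- optimum is zero.
      by_cases hv : ∃ v, v ∉ (F.induce (U j)).aux
      · obtain ⟨v, hv⟩ := hv
        obtain ⟨ops', h7, h8, h9⟩ := exists_OPT_le_cost h5 hv (3 * ms j)
        obtain ⟨tr, h10, h11, h12, h13⟩ := h6 ops' h7
        refine ⟨tr, h10, by omega, fun z hz => h12 z (by simpa using hz), h9.trans ?_⟩
        rw [Nat.cast_le]
        rw [Fintype.card_coe] at h13
        omega
      · refine ⟨[], True.intro, Nat.zero_le _, fun _ _ => rfl, ?_⟩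
        push Not at hv
        rw [OPT_eq_zero fun x _ hx => absurd (hv x) hx]
        exact zero_le
    obtain ⟨tr, h7, h8, h9, h10⟩ := key
    refine ⟨ops ++ tr, legal_append.2 ⟨h1, h7⟩, ?_, fun x hx => ?_, ?_⟩
    · rw [Finset.sum_insert hj, List.length_append]
      omega
    · rw [applyAll_append, h9 x (hx j (Finset.mem_insert_self j I))]
      exact h3 x fun i hi => hx i (Finset.mem_insert_of_mem hi)
    · rw [Finset.sum_insert hj, Finset.sum_insert hj, costFrom_append]
      refine (add_le_add h10 h4).trans ?_
      rw [← Nat.cast_add, Nat.cast_le]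
      omega

end Bounds

theorem lemmap :
    ∃ C : ℕ, ∀ (V : Type u) [Fintype V] (F : RootedForest V) (k : ℕ) (U : Fin k → Finset V)
      (m : ℕ) (ms : Fin k → ℕ),
      (∀ i j, i ≠ j → Disjoint (U i) (U j)) →
      (∀ v, ∃ i, v ∈ U i) →
      (∀ i, (F.induce (U i)).graph.Connected) →
      ∑ i, ms i = m →
      ∑ i, OPT (F.induce (U i)) (3 * ms i) ≤ (C : ℕ∞) * (OPT F m + (Fintype.card V : ℕ∞)) := by
  -- The bound obtained is 46n + 51m + 45 OPT(F, m). Inserting m ≤ 3 OPT(F, m) + 2 and 2 ≤ n gives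
  -- 97n + 198 OPT(F, m), so 300 leaves room.
  refine ⟨300, fun V _ F k U m ms hdisj _ hconn hm => ?_⟩
  classical
  -- If no tree has two non-auxiliary vertices, every tree sum is a single weight and all optima of
  -- the parts vanish. Otherwise `m` is bounded in terms of `OPT F m`.
  by_cases hF : ∀ x y, x ∉ F.aux → y ∉ F.aux → F.graph.Reachable x y → x = y
  · rw [Finset.sum_eq_zero]
    · exact zero_le
    · intro i _
      refine OPT_eq_zero (fun x y hx hy hxy => Subtype.ext (hF x y hx hy ?_)) _
      obtain ⟨a, h1, h2⟩ := reachable_iff.1 hxy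
      exact reachable_iff.2 ⟨a, induce_anc h1, induce_anc h2⟩
  push Not at hF
  obtain ⟨x, y, hx, hy, hxy, hne⟩ := hF
  obtain ⟨D, hD, hD'⟩ := exists_time_eq_OPT F (9 * m)
  obtain ⟨ops, h1, h2, -, h3⟩ := exists_sum_OPT_induce_le hD (ms := ms) hdisj hconn Finset.univ
  have hlen : ops.length ≤ 9 * m := by
    rw [← hm, Finset.mul_sum]
    exact h2
  have hcard : ∑ i, (U i).card ≤ Fintype.card V := by
    rw [← Finset.card_biUnion fun i _ j _ h => hdisj i j h]
    exact Finset.card_le_univ _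
  have hsum : ∑ i, ((U i).card + 6 * ms i) ≤ Fintype.card V + 6 * m := by
    rw [Finset.sum_add_distrib, ← Finset.mul_sum, hm]
    omega
  have h4 : (D.costFrom D.init ops : ℕ∞) ≤ 45 * (Fintype.card V + m + OPT F m) := by
    refine le_trans ?_ ((cost_le_time hx h1 hlen).trans (hD'.le.trans (OPT_nine_mul_le hx m)))
    rw [Nat.cast_le, cost]
    omega
  have h5 : (m : ℕ∞) ≤ 3 * OPT F m + 2 := le_three_mul_OPT_add_two hx hy hne hxy m
  have hpos : 2 ≤ Fintype.card V := Fintype.one_lt_card_iff.2 ⟨x, y, hne⟩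
  rw [Nat.cast_add] at h3
  refine h3.trans ((add_le_add (Nat.cast_le.2 hsum) h4).trans ?_)
  obtain ⟨c, hc⟩ := ENat.ne_top_iff_exists.1
    ((OPT_le_mul_card F m).trans_lt (ENat.natCast_lt_top _)).ne
  rw [← hc] at h5 ⊢
  norm_cast at h5 ⊢
  omega
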